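/- **Automata.** An automaton $A=\langle\Sigma,Q,\delta,I,F\rangle$ has an alphabet $\Sigma$, a set $Q$ of states, a transition function $\delta$ from $Q\times\Sigma$ to finite subsets of $Q$, a finite set $I\subseteq Q$ of initial states and a decidable set $F\subseteq Q$ of accepting states. Put $\delta(\mathbf q,c)=\bigcup_{q\in\mathbf q}\delta(q,c)$, $\gamma(\mathbf q,\varepsilon)=\mathbf q$, $\gamma(\mathbf q,s\circ c)=\delta(\gamma(\mathbf q,s),c)$ and $L(A)=\{s\mid\gamma(I,s)\cap F\neq\varnothing\}$. $A$ is a *prefix automaton* if for every string $s$ and every $q\in\gamma(I,s)$ there is a string $s'$ with $\gamma(\{q\},s')\cap F\ne\varnothing$. Below $\Sigma$ is the set of Unicode characters. **The language $L_B$.** Identifiers and member names $x,n$ are words of `\w+`. Literals $l$ are words of `\d+` (numbers), `"\w*"` (strings), `true`, `false` (booleans). With $\overline{\,\cdot\,}$ for repetition (comma-separated for parameters and arguments), the grammar is - $T ::= \texttt{number}\mid\texttt{string}\mid\texttt{boolean}\mid\texttt{(}\overline p\texttt{) => }T$, $\;p::=x\texttt{:}T$; - $e ::= l\mid x\mid\texttt{(}\overline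 p\texttt{) => }e\mid\texttt{(}e\texttt{)}\mid e\odot e\mid e\texttt{(}\overline e\texttt{)}\mid e\texttt{.}n$ (the first four are base expressions, the last three extensions); - $s ::= \texttt{let }x\texttt{:}T\texttt{;}\mid e\texttt{;}\mid\texttt{return }e\texttt{;}\mid\texttt{\{}\overline s\texttt{\}}\mid\texttt{function }x\texttt{(}\overline p\texttt{):}T\texttt{\{}\overline s\texttt{\}}\mid\texttt{if (}e\texttt{) }s\texttt{ else }s$; a program is a sequence $M=\overline s$. Blanks occur exactly where shown. Operators are nonempty strings; each type $S_1$ has finitely many operator signatures $S_1\odot S_2:T$, and $\mathrm{lookup}(S,n)$ is a partial function with finitely many members $n$ for each type $S$. The operator signatures and lookup are arbitrary. A type environment $\Gamma$ is a finite collection of pairs $(x:T)$; $\Gamma\cup\{x:T\}$ replaces an older entry for $x$. *Expressions* ($\Gamma\vdash e:T$): literals have their primitive type; $x:T$ if $(x:T)\in\Gamma$; $(\overline p)\Rightarrow e$ has type $(\overline p)\Rightarrow T$ if $\Gamma\cup\{\overline p\}\vdash e:T$; grouping preserves the type; $e_1\odot e_2:T$ if $e_i:S_i$ and $S_1\odot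 S_2:T$; $f(\overline e):R$ if $f:(\overline p)\Rightarrow R$ and the arguments have the parameter types one by one; $e.n:T$ if $e:S$ and $\mathrm{lookup}(S,n)=T$. Types are equal iff they are syntactically equal. *Return values* ($\Gamma\vdash\overline s:R$, "$\overline s$ ensures a return value of type $R$"): the judgement holds for a sequence if it holds for the part after its first statement (in the environment extended by the declared variable or function; for a first statement that is a function definition, its body must moreover ensure its declared return type); or if the first statement is $\texttt{return }e$ with $\Gamma\vdash e:R$, a block whose statements ensure $R$, or a conditional both of whose branches ensure $R$. A first statement $\texttt{return }e$ is covered only in this second way. *Statements* ($\Gamma_1\vdash s\rightarrowtail\Gamma_2$): $\texttt{let }x\texttt{:}T$ requires $x\notin\Gamma$ and adds $x:T$; $e$ must be typable; $\texttt{return }e$ is allowed only inside a function body and $e$ must have the declared return type of the innermost surrounding function; blocks and conditionals (with condition of type boolean) check their parts and leave $\Gamma$ unchanged; $\texttt{function }x(\overline p):R\{\overline s\}$ requires $x\notin\Gamma$, the body must be well-typed in $\Gamma_1\cup\{\overline p\}$ with $\Gamma_1=\Gamma\cup\{x:(\overline p)\Rightarrow R\}$ and must ensure a return value of type $R$ there,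 and the new environment is $\Gamma_1$; sequences pass the environment on. $L_B$ is the set of texts of programs that are well-typed from the empty environment, outside functions. **Type search.** An extension step leads from $T$ to $S$ if $T\odot X:S$ for some $\odot,X$, or $T=(\overline p)\Rightarrow S$, or $S=\mathrm{lookup}(T,n)$ for some $n$. $\mathrm{reachable}(T,G)$ is the depth-first search from $T$ along extension steps for $G$ that marks visited types and skips a step from $T'$ to $S$ if $\mathrm{pruneSearch}(T',G,S)$ holds. Here $\mathrm{pruneSearch}$ is an arbitrary predicate that restricts each search to a finite set of types. For a state $q$ of a partial expression, the set $\mathrm{derivable}(q)$ is: the literal's type within a literal; the identifier's type within the terminal of an identifier of $\Gamma$; the result type of the extension within an operator application, a call or a member access; all types before `(` of a grouped expression; $\{T\mid \exists D\in\mathrm{derivable}(q_e):\mathrm{reachable}(D,T)\}$ within a grouped expression whose inner state is $q_e$, and the type of the expression after its closing parenthesis; for a function literal, all function types whose parameters complete those read so far, before its body, and $\{(\overline p)\Rightarrow T\mid\exists D\in\mathrm{derivable}(q_e):\mathrm{reachable}(D,T)\}$ within its body with state $q_e$. **The automata.** All of the following are built by union, concatenation with terminals and recursion. - $A_T$ parses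 the types. - $A_e$ (in the environment $\Gamma$) is the union of the automata for identifiers of $\Gamma$, literals, $\texttt{(}e\texttt{)}$ and $\texttt{(}\overline p\texttt{) => }e$ (the body in $\Gamma\cup\{\overline p\}$). Every accepting state carries the type $T$ of the expression read; in addition to its own transitions, it has those of the initial states of the extensions valid for $T$: $\odot\,(A_e\downarrow R)$ for each signature $T\odot R:S$; a call with arguments parsed by $A_e\downarrow R_i$, if $T$ is a function type with parameter types $R_1,\dots,R_k$; and $\texttt{.}n$ for each member $n$ of $T$. - $A_e\downarrow G$ is $A_e$ with only those states $q$ kept for which $\mathrm{reachable}(D,G)$ for some $D\in\mathrm{derivable}(q)$, and with those states accepting whose type is $G$. - $A_s=A_{\rm decl}\cup A_{\rm expr}\cup A_{\rm ret}\cup A_{\rm block}\cup A_{\rm fun}\cup A_{\rm ite}$ follows the grammar and tracks the environment as in the typing rules: names in declarations and function definitions may be any words outside $\Gamma$; $A_{\rm ret}$ is empty outside functions and uses $A_e\downarrow R$ inside a function with return type $R$; conditions are parsed by $A_e\downarrow\texttt{boolean}$; local environments are discarded after blocks, conditionals and function bodies; the automaton tracks whether all execution paths of what was read return, and a function body can be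 closed only if they do. - $A_M=A_{\overline s}$ is the Kleene star of $A_s$, where each statement starts in the environment reached by the previous one; it starts in the empty environment, outside functions. **Lemma.** $A_M$ is a prefix automaton, and $L(A_M)\subseteq L_B$. -/

import Mathlib

/-! ## Automata over an alphabet, and the prefix property -/

/-- A (possibly infinite-state) nondeterministic automaton over the alphabet `α`. Every state and
symbol have a finite set of next states, there are finitely many initial states (finite sets are
given by lists), and acceptance is decidable. -/
structure Automaton (α : Type) where
  State : Type
  δ : State → α → List State
  I : List State
  F : State → Bool

namespace Automaton
variable {α : Type} (A : Automaton α)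

/-- The transition function on a finite set of states: the union of the results. -/
def δset (Q : List A.State) (c : α) : List A.State := Q.flatMap (fun q => A.δ q c)

/-- The traversal function: `γ(Q, ε) = Q` and `γ(Q, s ∘ c) = δ(γ(Q, s), c)`. -/
def γ (Q : List A.State) (s : List α) : List A.State := s.foldl A.δset Q

/-- The accepted language `L(A)`. -/
def language : Set (List α) := {s | ∃ q ∈ A.γ A.I s, A.F q = true}

/-- The prefix property: from every reachable state some accepting state can be reached. -/
def IsPrefixAutomaton : Prop :=
  ∀ (s : List α), ∀ q ∈ A.γ A.I s, ∃ s' : List α, ∃ q' ∈ A.γ [q] s', A.F q' = true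

end Automaton

/-! ## Characters and terminals -/

/-- The regular-expression class `\w`: ASCII letters, digits and underscore. -/
def isWordChar (c : Char) : Bool := c.isAlphanum || c == Char.ofNat 95

/-- The string with the given code points. -/
def chars (l : List ℕ) : List Char := l.map Char.ofNat

/-- The character `(`. -/
def cLParen : Char := Char.ofNat 40
/-- The character `)`. -/
def cRParen : Char := Char.ofNat 41
/-- The character `,`. -/
def cComma : Char := Char.ofNat 44
/-- The character `.`. -/
def cDot : Char := Char.ofNat 46
/-- The character `:`. -/
def cColon : Char := Char.ofNat 58
/-- The character `;`. -/
def cSemi : Char := Char.ofNat 59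
/-- The character `{`. -/
def cLBrace : Char := Char.ofNat 123
/-- The character `}`. -/
def cRBrace : Char := Char.ofNat 125
/-- The double quote. -/
def cQuote : Char := Char.ofNat 34
/-- The blank. -/
def cBlank : Char := Char.ofNat 32

/-- The terminal `number`. -/
def tNumber : List Char := chars [110, 117, 109, 98, 101, 114]
/-- The terminal `string`. -/
def tString : List Char := chars [115, 116, 114, 105, 110, 103]
/-- The terminal `boolean`. -/
def tBoolean : List Char := chars [98, 111, 111, 108, 101, 97, 110]
/-- The terminal `true`. -/
def tTrue : List Char := chars [116, 114, 117, 101]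
/-- The terminal `false`. -/
def tFalse : List Char := chars [102, 97, 108, 115, 101]
/-- The arrow `=>` with a blank on either side. -/
def tArrow : List Char := chars [32, 61, 62, 32]
/-- The terminal `let` with a blank behind it. -/
def tLet : List Char := chars [108, 101, 116, 32]
/-- The terminal `return` with a blank behind it. -/
def tReturn : List Char := chars [114, 101, 116, 117, 114, 110, 32]
/-- The terminal `function` with a blank behind it. -/
def tFunction : List Char := chars [102, 117, 110, 99, 116, 105, 111, 110, 32]
/-- The terminal `if`, a blank, and `(`. -/
def tIf : List Char := chars [105, 102, 32, 40]
/-- The terminal `else` with a blank behind it. -/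
def tElse : List Char := chars [101, 108, 115, 101, 32]

/-! ## Syntax of the language -/

/-- Identifiers and member names: words of the regular expression `\w+`. -/
abbrev Ident : Type := {s : List Char // s ≠ [] ∧ ∀ c ∈ s, isWordChar c = true}

/-- Numeric literals: words of the regular expression `\d+`. -/
abbrev NumLit : Type := {s : List Char // s ≠ [] ∧ ∀ c ∈ s, c.isDigit = true}

/-- Contents of string literals: words of the regular expression `\w*`. -/
abbrev StrLit : Type := {s : List Char // ∀ c ∈ s, isWordChar c = true}

/-- Operator symbols: nonempty strings. -/
abbrev OpSym : Type := {s : List Char // s ≠ []}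

/-- Types: the primitive types and function types `(x₁:T₁, …, xₙ:Tₙ) => R`. -/
inductive Ty : Type
  | number
  | string
  | boolean
  | fn (ps : List (Ident × Ty)) (r : Ty)

/-- A typed identifier `x:T`. -/
abbrev Param : Type := Ident × Ty

mutual
/-- Equality of types is decidable. -/
def Ty.decEq : (a b : Ty) → Decidable (a = b)
  | .number, .number => isTrue rfl
  | .string, .string => isTrue rfl
  | .boolean, .boolean => isTrue rfl
  | .fn ps r, .fn ps' r' =>
    match Ty.decEqParams ps ps', Ty.decEq r r' with
    | isTrue h, isTrue h' => isTrue (by rw [h, h'])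
    | isFalse h, _ => isFalse (by intro e; cases e; exact h rfl)
    | _, isFalse h => isFalse (by intro e; cases e; exact h rfl)
  | .number, .string => isFalse (by simp)
  | .number, .boolean => isFalse (by simp)
  | .number, .fn _ _ => isFalse (by simp)
  | .string, .number => isFalse (by simp)
  | .string, .boolean => isFalse (by simp)
  | .string, .fn _ _ => isFalse (by simp)
  | .boolean, .number => isFalse (by simp)
  | .boolean, .string => isFalse (by simp)
  | .boolean, .fn _ _ => isFalse (by simp)
  | .fn _ _, .number => isFalse (by simp)
  | .fn _ _, .string => isFalse (by simp)
  | .fn _ _, .boolean => isFalse (by simp)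

/-- Equality of parameter lists is decidable. -/
def Ty.decEqParams : (a b : List (Ident × Ty)) → Decidable (a = b)
  | [], [] => isTrue rfl
  | [], _ :: _ => isFalse (by simp)
  | _ :: _, [] => isFalse (by simp)
  | (x, T) :: ps, (y, S) :: qs =>
    if hx : x = y then
      match Ty.decEq T S, Ty.decEqParams ps qs with
      | isTrue h, isTrue h' => isTrue (by rw [hx, h, h'])
      | isFalse h, _ => isFalse (by intro e; cases e; exact h rfl)
      | _, isFalse h => isFalse (by intro e; cases e; exact h rfl)
    else isFalse (by intro e; cases e; exact hx rfl)
end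

instance : DecidableEq Ty := Ty.decEq

mutual
/-- The text of a type. -/
def Ty.text : Ty → List Char
  | .number => tNumber
  | .string => tString
  | .boolean => tBoolean
  | .fn ps r => [cLParen] ++ Ty.paramsText ps ++ [cRParen] ++ tArrow ++ r.text

/-- The text of a comma-separated list of typed identifiers. -/
def Ty.paramsText : List (Ident × Ty) → List Char
  | [] => []
  | [(x, T)] => x.1 ++ [cColon] ++ T.text
  | (x, T) :: p :: ps => x.1 ++ [cColon] ++ T.text ++ [cComma] ++ Ty.paramsText (p :: ps)
end

/-- Expressions. Base expressions: literals, identifiers, function literals `(ps) => e` and grouped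
expressions `(e)`. Extension expressions: `e ⊙ e`, `e(e₁,…,eₙ)` and `e.n`. -/
inductive Expr : Type
  | num (s : NumLit)
  | str (s : StrLit)
  | bool (b : Bool)
  | var (x : Ident)
  | anon (ps : List Param) (e : Expr)
  | group (e : Expr)
  | op (e₁ : Expr) (o : OpSym) (e₂ : Expr)
  | call (f : Expr) (args : List Expr)
  | member (e : Expr) (n : Ident)

/-- Statements: `let x:T;`, `e;`, `return e;`, `{s…}`, `function x(ps):R{s…}` and
`if (e) s else s`. -/
inductive Stmt : Type
  | decl (x : Ident) (T : Ty)
  | expr (e : Expr)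
  | ret (e : Expr)
  | block (ss : List Stmt)
  | func (x : Ident) (ps : List Param) (R : Ty) (body : List Stmt)
  | ite (e : Expr) (s₁ s₂ : Stmt)

mutual
/-- The text of an expression. -/
def Expr.text : Expr → List Char
  | .num s => s.1
  | .str s => [cQuote] ++ s.1 ++ [cQuote]
  | .bool b => if b then tTrue else tFalse
  | .var x => x.1
  | .anon ps e => [cLParen] ++ Ty.paramsText ps ++ [cRParen] ++ tArrow ++ e.text
  | .group e => [cLParen] ++ e.text ++ [cRParen]
  | .op e₁ o e₂ => e₁.text ++ o.1 ++ e₂.text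
  | .call f args => f.text ++ [cLParen] ++ Expr.argsText args ++ [cRParen]
  | .member e n => e.text ++ [cDot] ++ n.1

/-- The text of a comma-separated list of expressions. -/
def Expr.argsText : List Expr → List Char
  | [] => []
  | [e] => e.text
  | e :: e' :: es => e.text ++ [cComma] ++ Expr.argsText (e' :: es)
end

mutual
/-- The text of a statement. -/
def Stmt.text : Stmt → List Char
  | .decl x T => tLet ++ x.1 ++ [cColon] ++ T.text ++ [cSemi]
  | .expr e => e.text ++ [cSemi]
  | .ret e => tReturn ++ e.text ++ [cSemi]
  | .block ss => [cLBrace] ++ Stmt.seqText ss ++ [cRBrace]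
  | .func x ps R body => tFunction ++ x.1 ++ [cLParen] ++ Ty.paramsText ps ++ [cRParen] ++
      [cColon] ++ R.text ++ [cLBrace] ++ Stmt.seqText body ++ [cRBrace]
  | .ite e s₁ s₂ => tIf ++ e.text ++ [cRParen, cBlank] ++ s₁.text ++ [cBlank] ++ tElse ++ s₂.text

/-- The text of a sequence of statements. -/
def Stmt.seqText : List Stmt → List Char
  | [] => []
  | s :: ss => s.text ++ Stmt.seqText ss
end

/-! ## Type system -/

/-- The predefined part of the language. `(o, S₂, T) ∈ ops S₁` says that the operator `o` has the
signature `S₁ ⊙ S₂ : T`; `lookup S n` is the type of the member `n` of the type `S`, if there is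
one, and all members of `S` are listed in `members S`. -/
structure Lang : Type where
  ops : Ty → List (OpSym × Ty × Ty)
  lookup : Ty → Ident → Option Ty
  members : Ty → List Ident
  mem_members : ∀ (S : Ty) (n : Ident), (lookup S n).isSome → n ∈ members S

/-- Type environments: finite collections of typed identifiers. -/
abbrev Env : Type := List (Ident × Ty)

/-- The environment `Γ ∪ {x:T}`, where `x:T` shadows an earlier entry for `x`. -/
def Env.extend (Γ : Env) (x : Ident) (T : Ty) : Env := (x, T) :: Γ.filter (fun p => p.1 ≠ x)

/-- The environment `Γ ∪ {ps}`. -/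
def Env.extendParams (Γ : Env) (ps : List Param) : Env :=
  ps.foldl (fun Γ' p => Env.extend Γ' p.1 p.2) Γ

/-- `x ∉ Γ`: the identifier has no type in the environment. -/
def Env.Fresh (Γ : Env) (x : Ident) : Prop := x ∉ Γ.map Prod.fst

instance (Γ : Env) (x : Ident) : Decidable (Γ.Fresh x) :=
  inferInstanceAs (Decidable (x ∉ Γ.map Prod.fst))

namespace Lang
variable (L : Lang)

mutual
/-- The typing judgement `Γ ⊢ e : T`. -/
inductive HasType : Env → Expr → Ty → Prop
  | num (Γ : Env) (s : NumLit) : HasType Γ (.num s) .number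
  | str (Γ : Env) (s : StrLit) : HasType Γ (.str s) .string
  | bool (Γ : Env) (b : Bool) : HasType Γ (.bool b) .boolean
  | ident (Γ : Env) (x : Ident) (T : Ty) : (x, T) ∈ Γ → HasType Γ (.var x) T
  | anon (Γ : Env) (ps : List Param) (e : Expr) (T : Ty) :
      HasType (Γ.extendParams ps) e T → HasType Γ (.anon ps e) (.fn ps T)
  | group (Γ : Env) (e : Expr) (T : Ty) : HasType Γ e T → HasType Γ (.group e) T
  | op (Γ : Env) (e₁ e₂ : Expr) (o : OpSym) (S₁ S₂ T : Ty) :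
      HasType Γ e₁ S₁ → HasType Γ e₂ S₂ → (o, S₂, T) ∈ L.ops S₁ → HasType Γ (.op e₁ o e₂) T
  | call (Γ : Env) (f : Expr) (args : List Expr) (ps : List Param) (R : Ty) :
      HasType Γ f (.fn ps R) → ArgsHaveType Γ args (ps.map Prod.snd) → HasType Γ (.call f args) R
  | member (Γ : Env) (e : Expr) (n : Ident) (S T : Ty) :
      HasType Γ e S → L.lookup S n = some T → HasType Γ (.member e n) T

/-- The arguments have the listed types, one by one. -/
inductive ArgsHaveType : Env → List Expr → List Ty → Prop
  | nil (Γ : Env) : ArgsHaveType Γ [] []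
  | cons (Γ : Env) (e : Expr) (es : List Expr) (T : Ty) (Ts : List Ty) :
      HasType Γ e T → ArgsHaveType Γ es Ts → ArgsHaveType Γ (e :: es) (T :: Ts)
end

/-- The judgement `Γ ⊢ s… : R`: the sequence of statements ensures a return value of type `R`. -/
inductive Returns : Env → List Stmt → Ty → Prop
  | decl (Γ : Env) (x : Ident) (T : Ty) (ss : List Stmt) (R : Ty) :
      Returns (Γ.extend x T) ss R → Returns Γ (.decl x T :: ss) R
  | expr (Γ : Env) (e : Expr) (ss : List Stmt) (R : Ty) :
      Returns Γ ss R → Returns Γ (.expr e :: ss) R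
  | ret (Γ : Env) (e : Expr) (ss : List Stmt) (R : Ty) :
      L.HasType Γ e R → Returns Γ (.ret e :: ss) R
  | block_self (Γ : Env) (bs ss : List Stmt) (R : Ty) :
      Returns Γ bs R → Returns Γ (.block bs :: ss) R
  | block_next (Γ : Env) (bs ss : List Stmt) (R : Ty) :
      Returns Γ ss R → Returns Γ (.block bs :: ss) R
  | func (Γ : Env) (x : Ident) (ps : List Param) (R' : Ty) (body ss : List Stmt) (R : Ty) :
      Returns ((Γ.extend x (.fn ps R')).extendParams ps) body R' →
      Returns (Γ.extend x (.fn ps R')) ss R → Returns Γ (.func x ps R' body :: ss) R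
  | ite_self (Γ : Env) (e : Expr) (s₁ s₂ : Stmt) (ss : List Stmt) (R : Ty) :
      Returns Γ [s₁] R → Returns Γ [s₂] R → Returns Γ (.ite e s₁ s₂ :: ss) R
  | ite_next (Γ : Env) (e : Expr) (s₁ s₂ : Stmt) (ss : List Stmt) (R : Ty) :
      Returns Γ ss R → Returns Γ (.ite e s₁ s₂ :: ss) R

mutual
/-- The judgement `Γ₁ ⊢ s ↣ Γ₂`. The first argument is the declared return type of the surrounding
function, `none` outside function bodies. -/
inductive StmtOk : Option Ty → Env → Stmt → Env → Prop
  | decl (ρ : Option Ty) (Γ : Env) (x : Ident) (T : Ty) :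
      Γ.Fresh x → StmtOk ρ Γ (.decl x T) (Γ.extend x T)
  | expr (ρ : Option Ty) (Γ : Env) (e : Expr) (T : Ty) :
      L.HasType Γ e T → StmtOk ρ Γ (.expr e) Γ
  | ret (Γ : Env) (e : Expr) (R : Ty) :
      L.HasType Γ e R → StmtOk (some R) Γ (.ret e) Γ
  | block (ρ : Option Ty) (Γ Γ' : Env) (ss : List Stmt) :
      SeqOk ρ Γ ss Γ' → StmtOk ρ Γ (.block ss) Γ
  | func (ρ : Option Ty) (Γ Γ' : Env) (x : Ident) (ps : List Param) (R : Ty) (body : List Stmt) :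
      Γ.Fresh x →
      SeqOk (some R) ((Γ.extend x (.fn ps R)).extendParams ps) body Γ' →
      L.Returns ((Γ.extend x (.fn ps R)).extendParams ps) body R →
      StmtOk ρ Γ (.func x ps R body) (Γ.extend x (.fn ps R))
  | ite (ρ : Option Ty) (Γ Γ₁ Γ₂ : Env) (e : Expr) (s₁ s₂ : Stmt) :
      L.HasType Γ e .boolean → StmtOk ρ Γ s₁ Γ₁ → StmtOk ρ Γ s₂ Γ₂ → StmtOk ρ Γ (.ite e s₁ s₂) Γ

/-- The judgement `Γ₁ ⊢ s… ↣ Γ₂` for sequences of statements. -/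
inductive SeqOk : Option Ty → Env → List Stmt → Env → Prop
  | nop (ρ : Option Ty) (Γ : Env) : SeqOk ρ Γ [] Γ
  | seq (ρ : Option Ty) (Γ₁ Γ₂ Γ₃ : Env) (s : Stmt) (ss : List Stmt) :
      StmtOk ρ Γ₁ s Γ₂ → SeqOk ρ Γ₂ ss Γ₃ → SeqOk ρ Γ₁ (s :: ss) Γ₃
end

/-- The language `L_B`: the texts of the well-typed programs. -/
def programs : Set (List Char) :=
  {w | ∃ (M : List Stmt) (Γ : Env), L.SeqOk none [] M Γ ∧ Stmt.seqText M = w}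

end Lang

/-! ## Type reachability search -/

/-- The types obtained from `T` by one extension step: applying a binary operator, calling a
function, or accessing a member. -/
def Lang.extensions (L : Lang) (T : Ty) : List Ty :=
  (L.ops T).map (fun o => o.2.2) ++
  (match T with
    | .fn _ R => [R]
    | _ => []) ++
  (L.members T).filterMap (L.lookup T)

/-- A heuristic `pruneSearch(T, G, S)`, where `T` is the current type, `G` the goal and `S` the
type after the next extension step. It restricts the search for `G` that starts in `T` to a finite
set `bound T G` of types, which makes the search terminate. -/
structure Heuristic (L : Lang) : Type where
  prune : Ty → Ty → Ty → Bool
  bound : Ty → Ty → Finset Ty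
  self_mem : ∀ (T G : Ty), T ∈ bound T G
  step_mem : ∀ (T G T' S : Ty), T' ∈ bound T G → S ∈ L.extensions T' → prune T' G S = false →
    S ∈ bound T G

namespace Heuristic
variable {L : Lang} (H : Heuristic L)

/-- The depth-first search from the type `T` for the goal `G`, where the types in `marked` are
marked. It returns its answer and the types that are marked afterwards. The numeral bounds the
depth of the recursion. -/
def search (G : Ty) : ℕ → List Ty → Ty → Bool × List Ty
  | 0, marked, _ => (false, marked)
  | n + 1, marked, T =>
    if T = G then (true, marked)
    else if T ∈ marked then (false, marked)
    else (L.extensions T).foldl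
      (fun res S =>
        if res.1 then res
        else if H.prune T G S then res
        else search G n res.2 S)
      (false, T :: marked)

/-- The procedure `reachable(T, G)`. Every recursive call that is nested below the first one marks
a further type of `bound T G`, so that this depth is never exceeded. -/
def reachable (T G : Ty) : Bool := (H.search G ((H.bound T G).card + 1) [] T).1

end Heuristic

/-! ## Automata for literals and types -/

/-- Concatenation of the terminal `r` (not yet read) with the automaton whose initial states are
`next`, on the character `c`. The states within the terminal are `more r'`, with `r'` the rest. -/
def eat {Q : Type} (r : List Char) (c : Char) (more : List Char → Q) (next : List Q) : List Q :=
  match r with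
  | [] => []
  | [a] => if a = c then next else []
  | a :: r' => if a = c then [more r'] else []

/-- The identifier with the given text. -/
def toIdent (x : List Char) : Option Ident :=
  if h : x ≠ [] ∧ ∀ c ∈ x, isWordChar c = true then some ⟨x, h⟩ else none

/-- States of the literal automaton: numbers `\d+` (nothing read, something read), strings
(nothing read, opening quote read, closing quote read), and the terminals `true`, `false` with
the rest that is to be read. -/
inductive LitState : Type
  | num₀
  | num₁
  | str₀
  | str₁
  | str₂
  | bool (rest : List Char)

namespace LitState

/-- Initial states: the union of the automata for numbers, strings and booleans. -/
def start : List LitState := [num₀, str₀, bool tTrue, bool tFalse]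

/-- Transitions. -/
def step : LitState → Char → List LitState
  | num₀, c => if c.isDigit then [num₁] else []
  | num₁, c => if c.isDigit then [num₁] else []
  | str₀, c => if c = cQuote then [str₁] else []
  | str₁, c => (if isWordChar c then [str₁] else []) ++ (if c = cQuote then [str₂] else [])
  | str₂, _ => []
  | bool r, c => eat r c bool [bool []]

/-- The type of the literals that the state belongs to. -/
def type : LitState → Ty
  | num₀ => .number
  | num₁ => .number
  | str₀ => .string
  | str₁ => .string
  | str₂ => .string
  | bool _ => .boolean

/-- Accepting states. -/
def accepts : LitState → Bool
  | num₁ => true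
  | str₂ => true
  | bool [] => true
  | _ => false

end LitState

mutual
/-- States of the type automaton. -/
inductive TyState : Type
  /-- the keyword of a primitive type, with the rest that is to be read -/
  | kw (T : Ty) (rest : List Char)
  /-- a function type, before `(` -/
  | fnOpen
  /-- a function type, within the parameters -/
  | fnParams (p : ParamState)
  /-- a function type, within the terminal between parameters and return type -/
  | fnArrow (ps : List Param) (rest : List Char)
  /-- a function type, within the return type -/
  | fnRet (ps : List Param) (q : TyState)

/-- States of the automaton for comma-separated lists of typed identifiers. -/
inductive ParamState : Type
  /-- nothing read -/
  | empty
  /-- after the parameters `done` and a comma (if any), within an identifier -/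
  | name (done : List Param) (x : List Char)
  /-- after the parameters `done` and the identifier `x` and the colon, within a type -/
  | type (done : List Param) (x : Ident) (q : TyState)
end

/-- Initial states of the type automaton. -/
def TyState.start : List TyState :=
  [.kw .string tString, .kw .number tNumber, .kw .boolean tBoolean, .fnOpen]

/-- The type that was read, in accepting states. -/
def TyState.out : TyState → Option Ty
  | .kw T [] => some T
  | .fnRet ps q => q.out.map (Ty.fn ps)
  | _ => none

/-- The typed identifiers that were read, in accepting states. -/
def ParamState.out : ParamState → Option (List Param)
  | .empty => some []
  | .name _ _ => none
  | .type done x q => q.out.map (fun T => done ++ [(x, T)])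

mutual
/-- Transitions of the type automaton. -/
def TyState.step : TyState → Char → List TyState
  | .kw T r, c => eat r c (.kw T) [.kw T []]
  | .fnOpen, c => if c = cLParen then [.fnParams .empty] else []
  | .fnParams p, c =>
    (p.step c).map .fnParams ++
    (match p.out with
      | some ps => if c = cRParen then [.fnArrow ps tArrow] else []
      | none => [])
  | .fnArrow ps r, c => eat r c (.fnArrow ps) (TyState.start.map (.fnRet ps))
  | .fnRet ps q, c => (q.step c).map (.fnRet ps)

/-- Transitions of the automaton for lists of typed identifiers. -/
def ParamState.step : ParamState → Char → List ParamState
  | .empty, c => if isWordChar c then [.name [] [c]] else []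
  | .name done x, c =>
    (if isWordChar c then [.name done (x ++ [c])] else []) ++
    (match toIdent x with
      | some y => if c = cColon then TyState.start.map (.type done y) else []
      | none => [])
  | .type done x q, c =>
    (q.step c).map (.type done x) ++
    (match q.out with
      | some T => if c = cComma then [.name (done ++ [(x, T)]) []] else []
      | none => [])
end

/-- The automaton for comma-separated lists of typed identifiers. -/
def paramAutomaton : Automaton Char where
  State := ParamState
  δ := ParamState.step
  I := [.empty]
  F := fun p => p.out.isSome

/-! ## Automata for expressions -/

/-- States of the expression automaton. A state of an extension records, instead of the text of
the extended expression, the type information about it that later states depend on. -/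
inductive ExprState : Type
  /-- a literal -/
  | lit (q : LitState)
  /-- an identifier of type `T`, with the rest that is to be read -/
  | ident (T : Ty) (rest : List Char)
  /-- a grouped expression, before `(` -/
  | groupOpen
  /-- a grouped expression, within the inner expression -/
  | groupIn (q : ExprState)
  /-- a grouped expression of type `T`, after `)` -/
  | groupDone (T : Ty)
  /-- a function literal, before `(` -/
  | anonOpen
  /-- a function literal, within the parameters -/
  | anonParams (p : ParamState)
  /-- a function literal, within the terminal between parameters and body -/
  | anonArrow (ps : List Param) (rest : List Char)
  /-- a function literal, within the body -/
  | anonBody (ps : List Param) (q : ExprState)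
  /-- an operator with right operand of type `R` and result of type `S`, within the symbol -/
  | opSym (R S : Ty) (rest : List Char)
  /-- an operator, within the right operand, which is restricted to the type `R` -/
  | opArg (R S : Ty) (q : ExprState)
  /-- a call of a function with parameter types `Rs` and return type `S`, before `(` -/
  | callOpen (Rs : List Ty) (S : Ty)
  /-- a call without arguments, before `)` -/
  | callNil (S : Ty)
  /-- a call, within an argument, which is restricted to the type `R`; `Rs` are the types of the
  later arguments -/
  | callArg (R : Ty) (Rs : List Ty) (S : Ty) (q : ExprState)
  /-- a call, after `)` -/
  | callDone (S : Ty)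
  /-- access to a member of type `S`, with the rest of dot and name that is to be read -/
  | mem (S : Ty) (rest : List Char)

namespace ExprState

/-- Initial states of the unrestricted expression automaton in the environment `Γ`: the union of
the automata for the base expressions. -/
def start (Γ : Env) : List ExprState :=
  LitState.start.map .lit ++ Γ.map (fun p => .ident p.2 p.1.1) ++ [.groupOpen] ++ [.anonOpen]

/-- The type of the expression that was read, in accepting states. -/
def typ : ExprState → Option Ty
  | .lit q => if q.accepts then some q.type else none
  | .ident T [] => some T
  | .groupDone T => some T
  | .anonBody ps q => q.typ.map (Ty.fn ps)
  | .opArg R S q => if q.typ = some R then some S else none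
  | .callDone S => some S
  | .mem S [] => some S
  | _ => none

end ExprState

/-- The set `derivable(q)`: the types of the expressions that can be completed from `q` without
further extension of the expression read. -/
def Heuristic.derivable {L : Lang} (H : Heuristic L) : ExprState → Set Ty
  | .lit q => {q.type}
  | .ident T _ => {T}
  | .groupOpen => Set.univ
  | .groupIn q => {T | ∃ D ∈ H.derivable q, H.reachable D T = true}
  | .groupDone T => {T}
  | .anonOpen => {T | ∃ ps R, T = Ty.fn ps R}
  | .anonParams p => {T | ∃ w, ∃ p' ∈ paramAutomaton.γ [p] w, ∃ ps R,
      ParamState.out p' = some ps ∧ T = Ty.fn ps R}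
  | .anonArrow ps _ => {T | ∃ R, T = Ty.fn ps R}
  | .anonBody ps q => {T | ∃ R, T = Ty.fn ps R ∧ ∃ D ∈ H.derivable q, H.reachable D R = true}
  | .opSym _ S _ => {S}
  | .opArg _ S _ => {S}
  | .callOpen _ S => {S}
  | .callNil S => {S}
  | .callArg _ _ S _ => {S}
  | .callDone S => {S}
  | .mem S _ => {S}

/-- `reachable(derivable(q), G)`: the type search, started in one of the types derivable from the
state `q`, finds the goal `G`. -/
def Heuristic.CanReach {L : Lang} (H : Heuristic L) (G : Ty) (q : ExprState) : Prop :=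
  ∃ D ∈ H.derivable q, H.reachable D G = true

namespace ExprState
variable {L : Lang} (H : Heuristic L) [∀ G : Ty, DecidablePred (H.CanReach G)]

/-- The states among `qs` that survive in the automaton restricted to the type `G`. -/
def restrict (G : Ty) (qs : List ExprState) : List ExprState :=
  qs.filter (fun q => decide (H.CanReach G q))

/-- Initial states of the expression automaton restricted to the type `G`. -/
def startAt (Γ : Env) (G : Ty) : List ExprState := restrict H G (start Γ)

/-- Initial states of the rest of a call, given the types of the remaining arguments. -/
def callArgs (Γ : Env) (S : Ty) : List Ty → List ExprState
  | [] => [.callNil S]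
  | R :: Rs => (startAt H Γ R).map (.callArg R Rs S)

variable (L) in
/-- Initial states of the valid extensions of an expression of type `T`: operators, call, and
member access. -/
def extStart (T : Ty) : List ExprState :=
  (L.ops T).map (fun o => .opSym o.2.1 o.2.2 o.1.1) ++
  (match T with
    | .fn ps S => [.callOpen (ps.map Prod.snd) S]
    | _ => []) ++
  (L.members T).filterMap (fun n => (L.lookup T n).map (fun S => .mem S (cDot :: n.1)))

/-- Transitions of the active automaton from states in which it is not within a recursively
contained expression. -/
def leafStep (Γ : Env) : ExprState → Char → List ExprState
  | .lit q, c => (q.step c).map .lit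
  | .ident T r, c => eat r c (.ident T) [.ident T []]
  | .groupOpen, c => if c = cLParen then (start Γ).map .groupIn else []
  | .anonOpen, c => if c = cLParen then [.anonParams .empty] else []
  | .anonParams p, c =>
    (p.step c).map .anonParams ++
    (match p.out with
      | some ps => if c = cRParen then [.anonArrow ps tArrow] else []
      | none => [])
  | .anonArrow ps r, c =>
    eat r c (.anonArrow ps) ((start (Γ.extendParams ps)).map (.anonBody ps))
  | .opSym R S r, c => eat r c (.opSym R S) ((startAt H Γ R).map (.opArg R S))
  | .callOpen Rs S, c => if c = cLParen then callArgs H Γ S Rs else []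
  | .callNil S, c => if c = cRParen then [.callDone S] else []
  | .mem S r, c => eat r c (.mem S) [.mem S []]
  | _, _ => []

/-- Transitions from an accepting state into the extensions of the expression that was read. -/
def extStep (Γ : Env) (q : ExprState) (c : Char) : List ExprState :=
  match q.typ with
  | some T => (extStart L T).flatMap (fun q' => leafStep H Γ q' c)
  | none => []

/-- Transitions of the unrestricted expression automaton in the environment `Γ`: those of the
active automaton and, from its accepting states, those of the extensions. -/
def step (Γ : Env) : ExprState → Char → List ExprState
  | .groupIn q, c =>
    (step Γ q c).map .groupIn ++
    (match q.typ with
      | some T => if c = cRParen then [.groupDone T] else []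
      | none => [])
  | .anonBody ps q, c =>
    (step (Γ.extendParams ps) q c).map (.anonBody ps) ++ extStep H Γ (.anonBody ps q) c
  | .opArg R S q, c =>
    (restrict H R (step Γ q c)).map (.opArg R S) ++ extStep H Γ (.opArg R S q) c
  | .callArg R Rs S q, c =>
    (restrict H R (step Γ q c)).map (.callArg R Rs S) ++
    (if q.typ = some R then
      (match Rs with
        | [] => if c = cRParen then [.callDone S] else []
        | R' :: Rs' => if c = cComma then (startAt H Γ R').map (.callArg R' Rs' S) else [])
    else [])
  | q, c => leafStep H Γ q c ++ extStep H Γ q c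

/-- Transitions of the expression automaton restricted to the type `G`. -/
def stepAt (Γ : Env) (G : Ty) (q : ExprState) (c : Char) : List ExprState :=
  restrict H G (step H Γ q c)

end ExprState

/-! ## Automata for statements and programs -/

mutual
/-- States of the statement automaton. -/
inductive StmtState : Type
  /-- declaration, within `let` and the blank -/
  | declKw (rest : List Char)
  /-- declaration, within the identifier -/
  | declName (x : List Char)
  /-- declaration of `x`, within the type -/
  | declType (x : Ident) (q : TyState)
  /-- declaration `let x:T;` -/
  | declDone (x : Ident) (T : Ty)
  /-- expression statement, within the expression -/
  | exprIn (q : ExprState)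
  /-- expression statement, after the semicolon -/
  | exprDone
  /-- return statement, within `return` and the blank -/
  | retKw (rest : List Char)
  /-- return statement, within the expression, which is restricted to the type `R` -/
  | retIn (R : Ty) (q : ExprState)
  /-- return statement, after the semicolon -/
  | retDone
  /-- block, before the opening brace -/
  | blockOpen
  /-- block, within the statements -/
  | blockIn (q : SeqState)
  /-- block, after the closing brace; `r` tells whether all its execution paths return -/
  | blockDone (r : Bool)
  /-- function definition, within `function` and the blank -/
  | funcKw (rest : List Char)
  /-- function definition, within the identifier -/
  | funcName (x : List Char)
  /-- definition of the function `x`, within the parameters -/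
  | funcParams (x : Ident) (p : ParamState)
  /-- definition of the function `x`, before the colon -/
  | funcColon (x : Ident) (ps : List Param)
  /-- definition of the function `x`, within the return type -/
  | funcType (x : Ident) (ps : List Param) (q : TyState)
  /-- definition of the function `x` with return type `R`, within the body -/
  | funcBody (x : Ident) (ps : List Param) (R : Ty) (q : SeqState)
  /-- definition of the function `x`, after the closing brace -/
  | funcDone (x : Ident) (ps : List Param) (R : Ty)
  /-- if-then-else, within the terminal before the condition -/
  | iteKw (rest : List Char)
  /-- if-then-else, within the condition, which is restricted to `boolean` -/
  | iteCond (q : ExprState)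
  /-- if-then-else, before the blank behind the condition -/
  | iteBlank
  /-- if-then-else, within the first branch -/
  | iteThen (q : StmtState)
  /-- if-then-else, within `else` and the blank; `r` tells whether all execution paths of the first
  branch return -/
  | iteElseKw (r : Bool) (rest : List Char)
  /-- if-then-else, within the second branch -/
  | iteElse (r : Bool) (q : StmtState)

/-- States of the Kleene star of the statement automaton. The environment is passed on from each
statement to the next, and so is the flag that tells whether all execution paths through the
statements that were read return. -/
inductive SeqState : Type
  /-- initial state, with the environment and the flag at the beginning -/
  | init (Γ : Env) (r : Bool)
  /-- within a statement that begins with the environment `Γ` and the flag `r` -/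
  | inside (Γ : Env) (r : Bool) (q : StmtState)
end

mutual
/-- In accepting states of the statement automaton started in `Γ`: the environment after the
statement, and whether all execution paths through the statement return. -/
def StmtState.out (Γ : Env) : StmtState → Option (Env × Bool)
  | .declDone x T => some (Γ.extend x T, false)
  | .exprDone => some (Γ, false)
  | .retDone => some (Γ, true)
  | .blockDone r => some (Γ, r)
  | .funcDone x ps R => some (Γ.extend x (.fn ps R), false)
  | .iteElse r q => (StmtState.out Γ q).map (fun o => (Γ, r && o.2))
  | _ => none

/-- In accepting states of the automaton for sequences: the environment after the statements that
were read, and whether all execution paths through them return. -/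
def SeqState.out : SeqState → Option (Env × Bool)
  | .init Γ r => some (Γ, r)
  | .inside Γ r q => (StmtState.out Γ q).map (fun o => (o.1, r || o.2))
end

namespace StmtState
variable {L : Lang} (H : Heuristic L) [∀ G : Ty, DecidablePred (H.CanReach G)]

/-- Initial states of the statement automaton in the environment `Γ`, within a function with
return type `ρ` or (`ρ = none`) outside functions: the union of the automata for declarations,
expression statements, return statements, blocks, function definitions and if-then-else. -/
def start (Γ : Env) (ρ : Option Ty) : List StmtState :=
  [.declKw tLet] ++
  (ExprState.start Γ).map .exprIn ++
  (match ρ with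
    | some _ => [.retKw tReturn]
    | none => []) ++
  [.blockOpen] ++
  [.funcKw tFunction] ++
  [.iteKw tIf]

/-- Transitions from states that are not within a recursively contained statement. -/
def leafStep (Γ : Env) (ρ : Option Ty) : StmtState → Char → List StmtState
  | .declKw r, c => eat r c .declKw [.declName []]
  | .declName x, c =>
    (if isWordChar c then [.declName (x ++ [c])] else []) ++
    (match toIdent x with
      | some y => if c = cColon ∧ Γ.Fresh y then TyState.start.map (.declType y) else []
      | none => [])
  | .declType x q, c =>
    (q.step c).map (.declType x) ++
    (match q.out with
      | some T => if c = cSemi then [.declDone x T] else []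
      | none => [])
  | .exprIn q, c =>
    (ExprState.step H Γ q c).map .exprIn ++
    (if q.typ.isSome ∧ c = cSemi then [.exprDone] else [])
  | .retKw r, c =>
    match ρ with
    | some R => eat r c .retKw ((ExprState.startAt H Γ R).map (.retIn R))
    | none => []
  | .retIn R q, c =>
    (ExprState.stepAt H Γ R q c).map (.retIn R) ++
    (if q.typ = some R ∧ c = cSemi then [.retDone] else [])
  | .blockOpen, c => if c = cLBrace then [.blockIn (.init Γ false)] else []
  | .funcKw r, c => eat r c .funcKw [.funcName []]
  | .funcName x, c =>
    (if isWordChar c then [.funcName (x ++ [c])] else []) ++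
    (match toIdent x with
      | some y => if c = cLParen ∧ Γ.Fresh y then [.funcParams y .empty] else []
      | none => [])
  | .funcParams x p, c =>
    (p.step c).map (.funcParams x) ++
    (match p.out with
      | some ps => if c = cRParen then [.funcColon x ps] else []
      | none => [])
  | .funcColon x ps, c => if c = cColon then TyState.start.map (.funcType x ps) else []
  | .funcType x ps q, c =>
    (q.step c).map (.funcType x ps) ++
    (match q.out with
      | some R =>
        if c = cLBrace then
          [.funcBody x ps R (.init ((Γ.extend x (.fn ps R)).extendParams ps) false)]
        else []
      | none => [])
  | .iteKw r, c => eat r c .iteKw ((ExprState.startAt H Γ .boolean).map .iteCond)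
  | .iteCond q, c =>
    (ExprState.stepAt H Γ .boolean q c).map .iteCond ++
    (if q.typ = some .boolean ∧ c = cRParen then [.iteBlank] else [])
  | .iteBlank, c => if c = cBlank then (start Γ ρ).map .iteThen else []
  | .iteElseKw r t, c => eat t c (.iteElseKw r) ((start Γ ρ).map (.iteElse r))
  | _, _ => []

/-- Transitions from the initial states. -/
def startStep (Γ : Env) (ρ : Option Ty) (c : Char) : List StmtState :=
  (start Γ ρ).flatMap (fun q => leafStep H Γ ρ q c)

end StmtState

section
variable {L : Lang} (H : Heuristic L) [∀ G : Ty, DecidablePred (H.CanReach G)]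

mutual
/-- Transitions of the statement automaton in the environment `Γ`, within a function with return
type `ρ` or (`ρ = none`) outside functions. A function body can be closed only if all its
execution paths return. -/
def StmtState.step (Γ : Env) (ρ : Option Ty) : StmtState → Char → List StmtState
  | .blockIn q, c =>
    (SeqState.step ρ q c).map .blockIn ++
    (match q.out with
      | some o => if c = cRBrace then [.blockDone o.2] else []
      | none => [])
  | .funcBody x ps R q, c =>
    (SeqState.step (some R) q c).map (.funcBody x ps R) ++
    (match q.out with
      | some o => if c = cRBrace ∧ o.2 = true then [.funcDone x ps R] else []
      | none => [])
  | .iteThen q, c =>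
    (StmtState.step Γ ρ q c).map .iteThen ++
    (match StmtState.out Γ q with
      | some o => if c = cBlank then [.iteElseKw o.2 tElse] else []
      | none => [])
  | .iteElse r q, c => (StmtState.step Γ ρ q c).map (.iteElse r)
  | q, c => StmtState.leafStep H Γ ρ q c

/-- Transitions of the Kleene star of the statement automaton: those of the statement automaton
and, from its accepting states, those of its initial states in the environment reached. -/
def SeqState.step (ρ : Option Ty) : SeqState → Char → List SeqState
  | .init Γ r, c => (StmtState.startStep H Γ ρ c).map (.inside Γ r)
  | .inside Γ r q, c =>
    (StmtState.step Γ ρ q c).map (.inside Γ r) ++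
    (match StmtState.out Γ q with
      | some o => (StmtState.startStep H o.1 ρ c).map (.inside o.1 (r || o.2))
      | none => [])
end

/-- The program automaton: the Kleene star of the statement automaton, started in the empty type
environment and outside functions. -/
def programAutomaton : Automaton Char where
  State := SeqState
  δ := SeqState.step H none
  I := [.init [] false]
  F := fun q => q.out.isSome

end

-- One invariant carries both claims. `Reads q s` says that `s` splits, in the way recorded by the
-- state `q`, into texts of well-typed pieces followed by the piece in progress. It also keeps what
-- completion needs: names are fresh, a partial operand, argument, condition or returned expression
-- has passed the filter for its required type (`CanReach`), and a set flag means a guaranteed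
-- return. It holds initially and all transitions preserve it (`ExprState.Reads.step`,
-- `StmtState.Reads.step`, `SeqState.Reads.step`). In an accepting state nothing is left in
-- progress, so the string is the text of a well-typed program (`SeqState.Reads.exists_stmts`); this
-- gives the inclusion of languages.
--
-- For the prefix property, every state with the invariant has to be continued to acceptance. The
-- heart is `ExprState.Reads.completes`: if the search finds `G` from a type `D` derivable from `q`,
-- then the automaton restricted to `G` leads from `q` to an expression of type `G`. The part in
-- progress is finished at type `D` (before the parenthesis of a group, at `G` itself). Missing
-- operands, arguments and bodies can always be supplied, because literals and function literals
-- inhabit every type in every environment (`ExprState.inhabited`). Extensions along the types that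
-- the search passes then lead from `D` to `G` (`Completes.extend_of_reachable`). No state on the
-- way is filtered out, since the rest of the path still leads from its derivable type to `G`.
-- Contained expressions are completed in the same way against their own goal, by recursion on the
-- state.
--
-- This uses that the search succeeds exactly if a path of unskipped extension steps exists
-- (`Heuristic.reachable_iff`). The delicate half is that marking visited types never hides the
-- goal: the marks left by a failing search are closed under unskipped steps.
--
-- For statements the fillers are simple: a name is lengthened until it is fresh, a missing type
-- becomes `number`, a missing branch becomes an empty block, and a function body is closed after
-- one more return statement.

open Relation

/-! ## Paths in automata -/

namespace Automaton
variable {α : Type} (A : Automaton α)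

/-- Some symbol leads from `q` to `q'`. -/
def Step (q q' : A.State) : Prop := ∃ c, q' ∈ A.δ q c

theorem mem_δset {Q : List A.State} {c : α} {q' : A.State} :
    q' ∈ A.δset Q c ↔ ∃ q ∈ Q, q' ∈ A.δ q c := by
  simp [δset]

theorem mem_γ_append_singleton {Q : List A.State} {s : List α} {c : α} {q' : A.State} :
    q' ∈ A.γ Q (s ++ [c]) ↔ ∃ q ∈ A.γ Q s, q' ∈ A.δ q c := by
  simp [γ, List.foldl_append, mem_δset]

theorem mem_γ_iff_exists_mem {Q : List A.State} {s : List α} {q' : A.State} :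
    q' ∈ A.γ Q s ↔ ∃ q ∈ Q, q' ∈ A.γ [q] s := by
  induction s generalizing Q with
  | nil => simp [γ]
  | cons c s ih =>
    change q' ∈ A.γ (A.δset Q c) s ↔ ∃ q ∈ Q, q' ∈ A.γ (A.δset [q] c) s
    rw [ih]
    simp only [ih (Q := A.δset [_] c), mem_δset]
    constructor
    · rintro ⟨p, ⟨q, hq, hp⟩, h⟩
      exact ⟨q, hq, p, ⟨q, by simp, hp⟩, h⟩
    · rintro ⟨q, hq, p, ⟨r, hr, hp⟩, h⟩
      obtain rfl : r = q := by simpa using hr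
      exact ⟨p, ⟨r, hq, hp⟩, h⟩

theorem mem_γ_singleton_cons {q q' : A.State} {c : α} {s : List α} :
    q' ∈ A.γ [q] (c :: s) ↔ ∃ p ∈ A.δ q c, q' ∈ A.γ [p] s := by
  change q' ∈ A.γ (A.δset [q] c) s ↔ _
  rw [mem_γ_iff_exists_mem]
  simp [δset]

/-- Turns the prefix property into reachability in a graph, so that completions can be composed and
lifted through nested states without ever naming the completing string. -/
theorem exists_mem_γ_iff {q q' : A.State} :
    (∃ s, q' ∈ A.γ [q] s) ↔ ReflTransGen A.Step q q' := by
  constructor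
  · rintro ⟨s, h⟩
    induction s generalizing q with
    | nil =>
      obtain rfl : q' = q := by simpa [γ] using h
      exact .refl
    | cons c s ih =>
      obtain ⟨p, hp, h⟩ := (A.mem_γ_singleton_cons).1 h
      exact .head ⟨c, hp⟩ (ih h)
  · intro h
    induction h using ReflTransGen.head_induction_on with
    | refl => exact ⟨[], by simp [γ]⟩
    | head h _ ih =>
      obtain ⟨c, hc⟩ := h
      obtain ⟨s, hs⟩ := ih
      exact ⟨c :: s, (A.mem_γ_singleton_cons).2 ⟨_, hc, hs⟩⟩

/-- A relation between strings and states that holds initially and is kept by all transitions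
holds after every run. -/
theorem invariant_of_mem_γ {P : A.State → List α → Prop} (hI : ∀ q ∈ A.I, P q [])
    (hδ : ∀ q s c, P q s → ∀ q' ∈ A.δ q c, P q' (s ++ [c])) {s : List α} {q : A.State}
    (hq : q ∈ A.γ A.I s) : P q s := by
  induction s using List.reverseRecOn generalizing q with
  | nil => exact hI q hq
  | append_singleton s c ih =>
    obtain ⟨p, hp, hq⟩ := (A.mem_γ_append_singleton).1 hq
    exact hδ p s c (ih hp) q hq

end Automaton

/-! ## Terminals -/

/-- The end of the terminal is a separate case because `eat` passes directly to `next` there; a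
state `more []` is entered only if `next` contains it. -/
theorem mem_eat {Q : Type} {r : List Char} {c : Char} {more : List Char → Q} {next : List Q}
    {q : Q} :
    q ∈ eat r c more next ↔
      ∃ r', r = c :: r' ∧ (r' = [] ∧ q ∈ next ∨ r' ≠ [] ∧ q = more r') := by
  rcases r with _ | ⟨a, _ | ⟨b, r⟩⟩
  · simp [eat]
  · simp only [eat]
    split_ifs with h
    · simp [h]
    · simp [h]
  · simp only [eat]
    split_ifs with h
    · simp [h]
    · simp [h]

/-- A terminal can be read to its end. -/
theorem reflTransGen_of_eat {Q : Type} {R : Q → Q → Prop} {more : List Char → Q} {q : Q}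
    (h₁ : ∀ a r, r ≠ [] → R (more (a :: r)) (more r)) (h₂ : ∀ a, R (more [a]) q) :
    ∀ {r : List Char}, r ≠ [] → ReflTransGen R (more r) q
  | [], h => absurd rfl h
  | [a], _ => .single (h₂ a)
  | a :: b :: r, _ => .head (h₁ a _ (by simp)) (reflTransGen_of_eat h₁ h₂ (by simp))

theorem toIdent_eq_some {x : List Char} {y : Ident} : toIdent x = some y ↔ y.1 = x := by
  unfold toIdent
  split_ifs with h
  · constructor
    · rintro h
      cases h
      rfl
    · rintro rfl
      rfl
  · simp only [false_iff]
    rintro rfl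
    exact h y.2

theorem toIdent_val (y : Ident) : toIdent y.1 = some y := toIdent_eq_some.2 rfl

/-- All characters are word characters. -/
def IsWord (x : List Char) : Prop := ∀ c ∈ x, isWordChar c = true

theorem IsWord.append_singleton {x : List Char} {c : Char} (hx : IsWord x)
    (hc : isWordChar c = true) : IsWord (x ++ [c]) := by
  intro a ha
  rcases List.mem_append.1 ha with h | h
  · exact hx a h
  · obtain rfl : a = c := by simpa using h
    exact hc

/-- A word can be read to a given end. -/
theorem reflTransGen_of_isWord {Q : Type} {R : Q → Q → Prop} {f : List Char → Q}
    (h : ∀ x c, isWordChar c = true → R (f x) (f (x ++ [c]))) :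
    ∀ x y : List Char, IsWord y → ReflTransGen R (f x) (f (x ++ y))
  | x, [], _ => by simpa using .refl
  | x, c :: y, hy => by
    have h' := reflTransGen_of_isWord h (x ++ [c]) y fun a ha => hy a (by simp [ha])
    rw [List.append_assoc, List.singleton_append] at h'
    exact .head (h x c (hy c (by simp))) h'

theorem isWordChar_digit_zero : isWordChar (Char.ofNat 48) = true := by decide

/-- Every word can be continued to an identifier outside a given list. -/
theorem exists_fresh_ident {x : List Char} (hx : IsWord x) (l : List Ident) :
    ∃ (z : List Char) (y : Ident), IsWord z ∧ y.1 = x ++ z ∧ y ∉ l := by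
  have hz : ∀ n, IsWord (List.replicate n (Char.ofNat 48)) := by
    intro n a ha
    rw [List.eq_of_mem_replicate ha]
    exact isWordChar_digit_zero
  -- Padding with zeros gives infinitely many identifiers, so one lies outside the finite list. The
  -- exponent `n + 1` keeps them nonempty even if `x` is empty.
  let f : ℕ → Ident := fun n =>
    ⟨x ++ List.replicate (n + 1) (Char.ofNat 48), by simp,
      fun a ha => (List.mem_append.1 ha).elim (hx a) (hz (n + 1) a)⟩
  have hf : Function.Injective f := by
    intro m n h
    have := congrArg (fun y : Ident => y.1.length) h
    simpa [f] using this
  obtain ⟨_, ⟨n, rfl⟩, hn⟩ := (Set.infinite_range_of_injective hf).exists_notMem_finset l.toFinset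
  exact ⟨_, f n, hz (n + 1), rfl, by simpa using hn⟩

/-! ## Types and parameter lists -/

/-- The text of typed identifiers with a comma behind each of them. -/
def paramsPrefix (ps : List Param) : List Char :=
  ps.flatMap (fun p => p.1.1 ++ [cColon] ++ p.2.text ++ [cComma])

theorem paramsPrefix_append_singleton (ps : List Param) (x : Ident) (T : Ty) :
    paramsPrefix (ps ++ [(x, T)]) = paramsPrefix ps ++ (x.1 ++ [cColon] ++ T.text ++ [cComma]) := by
  simp [paramsPrefix]

/-- The automaton collects finished parameters on the right, whereas `Ty.paramsText` recurses from
the left; this bridges the two. -/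
theorem paramsText_append_singleton (ps : List Param) (x : Ident) (T : Ty) :
    Ty.paramsText (ps ++ [(x, T)]) = paramsPrefix ps ++ (x.1 ++ [cColon] ++ T.text) := by
  induction ps with
  | nil => simp [paramsPrefix, Ty.paramsText]
  | cons p ps ih =>
    obtain ⟨p, ps', h⟩ : ∃ p' ps', ps ++ [(x, T)] = p' :: ps' := by
      cases ps <;> simp
    rw [List.cons_append, h, Ty.paramsText, ← h, ih]
    simp [paramsPrefix]

mutual
/-- The type automaton can be in the given state after the given string. -/
def TyState.Reads : TyState → List Char → Prop
  | .kw T r, s => s ++ r = T.text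
  | .fnOpen, s => s = []
  | .fnParams p, s => ∃ t, s = cLParen :: t ∧ p.Reads t
  -- An exhausted terminal would be a dead state here, neither accepting nor with transitions; the
  -- invariant rules it out.
  | .fnArrow ps r, s => r ≠ [] ∧
      ∃ t, t ++ r = tArrow ∧ s = [cLParen] ++ Ty.paramsText ps ++ [cRParen] ++ t
  | .fnRet ps q, s =>
      ∃ t, s = [cLParen] ++ Ty.paramsText ps ++ [cRParen] ++ tArrow ++ t ∧ q.Reads t

/-- The automaton for parameter lists can be in the given state after the given string. -/
def ParamState.Reads : ParamState → List Char → Prop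
  | .empty, s => s = []
  | .name done x, s => IsWord x ∧ s = paramsPrefix done ++ x
  | .type done x q, s => ∃ t, s = paramsPrefix done ++ (x.1 ++ [cColon] ++ t) ∧ q.Reads t
end

theorem TyState.reads_start {q : TyState} (h : q ∈ TyState.start) : q.Reads [] := by
  simp only [TyState.start, List.mem_cons, List.not_mem_nil, or_false] at h
  rcases h with rfl | rfl | rfl | rfl <;> simp [TyState.Reads, Ty.text]

theorem TyState.text_of_out : ∀ {q : TyState} {s : List Char} {T : Ty},
    q.Reads s → q.out = some T → T.text = s
  | .kw T [], s, T', h, ho => by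
    obtain rfl : T = T' := by simpa [TyState.out] using ho
    simpa [TyState.Reads] using h.symm
  | .kw _ (_ :: _), _, _, _, ho => by simp [TyState.out] at ho
  | .fnOpen, _, _, _, ho => by simp [TyState.out] at ho
  | .fnParams _, _, _, _, ho => by simp [TyState.out] at ho
  | .fnArrow _ _, _, _, _, ho => by simp [TyState.out] at ho
  | .fnRet ps q, s, T', h, ho => by
    obtain ⟨t, rfl, h⟩ := h
    simp only [TyState.out, Option.map_eq_some_iff] at ho
    obtain ⟨R, hR, rfl⟩ := ho
    rw [Ty.text, TyState.text_of_out h hR]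

theorem ParamState.text_of_out {p : ParamState} {s : List Char} {ps : List Param}
    (h : p.Reads s) (ho : p.out = some ps) : Ty.paramsText ps = s := by
  cases p with
  | empty =>
    obtain rfl : ps = [] := by simpa [ParamState.out] using ho.symm
    simpa [ParamState.Reads, Ty.paramsText] using h.symm
  | name done x => simp [ParamState.out] at ho
  | type done x q =>
    obtain ⟨t, rfl, h⟩ := h
    simp only [ParamState.out, Option.map_eq_some_iff] at ho
    obtain ⟨T, hT, rfl⟩ := ho
    rw [paramsText_append_singleton, TyState.text_of_out h hT]

mutual
theorem TyState.Reads.step : ∀ {q : TyState} {s : List Char} {c : Char}, q.Reads s →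
    ∀ q' ∈ q.step c, q'.Reads (s ++ [c])
  | .kw T r, s, c, h, q', hq => by
    rw [TyState.step, mem_eat] at hq
    obtain ⟨r', rfl, ⟨rfl, hq⟩ | ⟨-, rfl⟩⟩ := hq
    · obtain rfl : q' = .kw T [] := by simpa using hq
      simpa [TyState.Reads] using h
    · simpa [TyState.Reads] using h
  | .fnOpen, s, c, h, q', hq => by
    obtain rfl : s = [] := h
    simp only [TyState.step] at hq
    split_ifs at hq with hc
    · obtain rfl : q' = .fnParams .empty := by simpa using hq
      exact ⟨[], by simp [hc], rfl⟩
    · simp at hq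
  | .fnParams p, s, c, h, q', hq => by
    obtain ⟨t, rfl, h⟩ := h
    simp only [TyState.step, List.mem_append, List.mem_map] at hq
    rcases hq with ⟨p', hp', rfl⟩ | hq
    · exact ⟨t ++ [c], by simp, h.step p' hp'⟩
    · split at hq
      · rename_i ps hps
        split_ifs at hq with hc
        · obtain rfl : q' = .fnArrow ps tArrow := by simpa using hq
          exact ⟨by simp [tArrow, chars], [], rfl, by simp [hc, ParamState.text_of_out h hps]⟩
        · simp at hq
      · simp at hq
  | .fnArrow ps r, s, c, h, q', hq => by
    obtain ⟨-, t, ht, rfl⟩ := h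
    rw [TyState.step, mem_eat] at hq
    obtain ⟨r', rfl, ⟨rfl, hq⟩ | ⟨hr', rfl⟩⟩ := hq
    · obtain ⟨p, hp, rfl⟩ := List.mem_map.1 hq
      exact ⟨[], by simp [← ht], TyState.reads_start hp⟩
    · exact ⟨hr', t ++ [c], by simp [← ht], by simp⟩
  | .fnRet ps q, s, c, h, q', hq => by
    obtain ⟨t, rfl, h⟩ := h
    simp only [TyState.step, List.mem_map] at hq
    obtain ⟨p', hp', rfl⟩ := hq
    exact ⟨t ++ [c], by simp, h.step p' hp'⟩

theorem ParamState.Reads.step : ∀ {p : ParamState} {s : List Char} {c : Char}, p.Reads s →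
    ∀ p' ∈ p.step c, p'.Reads (s ++ [c])
  | .empty, s, c, h, p', hp => by
    obtain rfl : s = [] := h
    simp only [ParamState.step] at hp
    split_ifs at hp with hc
    · obtain rfl : p' = .name [] [c] := by simpa using hp
      exact ⟨by simpa [IsWord] using hc, by simp [paramsPrefix]⟩
    · simp at hp
  | .name done x, s, c, h, p', hp => by
    obtain ⟨hx, rfl⟩ := h
    simp only [ParamState.step, List.mem_append] at hp
    rcases hp with hp | hp
    · split_ifs at hp with hc
      · obtain rfl : p' = .name done (x ++ [c]) := by simpa using hp
        exact ⟨hx.append_singleton hc, by simp⟩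
      · simp at hp
    · split at hp
      · rename_i y hy
        split_ifs at hp with hc
        · obtain ⟨q, hq, rfl⟩ := List.mem_map.1 hp
          exact ⟨[], by simp [hc, toIdent_eq_some.1 hy], TyState.reads_start hq⟩
        · simp at hp
      · simp at hp
  | .type done x q, s, c, h, p', hp => by
    obtain ⟨t, rfl, h⟩ := h
    simp only [ParamState.step, List.mem_append, List.mem_map] at hp
    rcases hp with ⟨q', hq', rfl⟩ | hp
    · exact ⟨t ++ [c], by simp, h.step q' hq'⟩
    · split at hp
      · rename_i T hT
        split_ifs at hp with hc
        · obtain rfl : p' = .name (done ++ [(x, T)]) [] := by simpa using hp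
          exact ⟨by simp [IsWord],
            by simp [hc, paramsPrefix_append_singleton, TyState.text_of_out h hT]⟩
        · simp at hp
      · simp at hp
end

-- Completions in the automata for types and parameter lists

/-- Some character leads from one state of the type automaton to another. -/
def TyState.Next (q q' : TyState) : Prop := ∃ c, q' ∈ q.step c

/-- Some character leads from one state of the automaton for parameter lists to another. -/
def ParamState.Next (p p' : ParamState) : Prop := ∃ c, p' ∈ p.step c

theorem TyState.reflTransGen_kw (T : Ty) : ∀ r, ReflTransGen TyState.Next (.kw T r) (.kw T [])
  | [] => .refl
  | a :: r => reflTransGen_of_eat (more := TyState.kw T)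
      (fun a r hr => ⟨a, by simp [TyState.step, mem_eat, hr]⟩)
      (fun a => ⟨a, by simp [TyState.step, mem_eat]⟩) (by simp)

/-- Transitions of a component are also transitions of the state that contains it, so paths lift.
The same pattern recurs for all nested states. -/
theorem TyState.reflTransGen_fnParams {p p' : ParamState} (h : ReflTransGen ParamState.Next p p') :
    ReflTransGen TyState.Next (.fnParams p) (.fnParams p') :=
  h.lift _ fun a b ⟨c, hc⟩ => ⟨c, by simp [TyState.step, hc]⟩

theorem TyState.reflTransGen_fnRet (ps : List Param) {q q' : TyState}
    (h : ReflTransGen TyState.Next q q') :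
    ReflTransGen TyState.Next (.fnRet ps q) (.fnRet ps q') :=
  h.lift _ fun a b ⟨c, hc⟩ => ⟨c, by simp [TyState.step, hc]⟩

theorem ParamState.reflTransGen_type (done : List Param) (x : Ident) {q q' : TyState}
    (h : ReflTransGen TyState.Next q q') :
    ReflTransGen ParamState.Next (.type done x q) (.type done x q') :=
  h.lift _ fun a b ⟨c, hc⟩ => ⟨c, by simp [ParamState.step, hc]⟩

theorem TyState.reflTransGen_fnArrow (ps : List Param) {r : List Char} (hr : r ≠ [])
    {q : TyState} (hq : q ∈ TyState.start) :
    ReflTransGen TyState.Next (.fnArrow ps r) (.fnRet ps q) :=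
  reflTransGen_of_eat (more := TyState.fnArrow ps)
    (fun a r hr => ⟨a, by simp [TyState.step, mem_eat, hr]⟩)
    (fun a => ⟨a, by simp [TyState.step, mem_eat, hq]⟩) hr

theorem TyState.next_fnParams {p : ParamState} {ps : List Param} (h : p.out = some ps) :
    TyState.Next (.fnParams p) (.fnArrow ps tArrow) :=
  ⟨cRParen, by simp [TyState.step, h]⟩

theorem tArrow_ne_nil : tArrow ≠ [] := by simp [tArrow, chars]

theorem ParamState.reflTransGen_name (done : List Param) (x y : List Char) (hy : IsWord y) :
    ReflTransGen ParamState.Next (.name done x) (.name done (x ++ y)) :=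
  reflTransGen_of_isWord (fun x c hc => ⟨c, by simp [ParamState.step, hc]⟩) x y hy

theorem ParamState.next_name (done : List Param) (y : Ident) {q : TyState}
    (hq : q ∈ TyState.start) : ParamState.Next (.name done y.1) (.type done y q) :=
  ⟨cColon, by simp [ParamState.step, toIdent_val, hq]⟩

/-- The automaton for parameter lists goes from `name` states to the end of the next parameter. -/
theorem ParamState.exists_reflTransGen_name_out (done : List Param) (y : Ident) {T : Ty}
    (hT : ∃ q ∈ TyState.start, ∃ q', ReflTransGen TyState.Next q q' ∧ q'.out = some T) :
    ∃ p', ReflTransGen ParamState.Next (.name done y.1) p' ∧ p'.out = some (done ++ [(y, T)]) ∧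
      ParamState.Next p' (.name (done ++ [(y, T)]) []) := by
  obtain ⟨q, hq, q', hqq', hT⟩ := hT
  exact ⟨.type done y q', .head (ParamState.next_name done y hq)
    (ParamState.reflTransGen_type done y hqq'), by simp [ParamState.out, hT],
    cComma, by simp [ParamState.step, hT]⟩

-- Reading some type would not be enough: a function literal of which nothing is read must be
-- completed to a prescribed function type, hence with exactly its parameter list.
mutual
/-- Every type is read by the type automaton. -/
theorem TyState.exists_reflTransGen_start_out : ∀ T : Ty,
    ∃ q ∈ TyState.start, ∃ q', ReflTransGen TyState.Next q q' ∧ q'.out = some T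
  | .number => ⟨.kw .number tNumber, by simp [TyState.start], _, TyState.reflTransGen_kw _ _, rfl⟩
  | .string => ⟨.kw .string tString, by simp [TyState.start], _, TyState.reflTransGen_kw _ _, rfl⟩
  | .boolean =>
    ⟨.kw .boolean tBoolean, by simp [TyState.start], _, TyState.reflTransGen_kw _ _, rfl⟩
  | .fn ps R => by
    obtain ⟨p, hp, hps⟩ := ParamState.exists_reflTransGen_empty_out ps
    obtain ⟨q, hq, q', hqq', hR⟩ := TyState.exists_reflTransGen_start_out R
    refine ⟨.fnOpen, by simp [TyState.start], .fnRet ps q', ?_, by simp [TyState.out, hR]⟩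
    refine .head (b := .fnParams .empty) ⟨cLParen, by simp [TyState.step]⟩ ?_
    refine (TyState.reflTransGen_fnParams hp).trans (.head (TyState.next_fnParams hps) ?_)
    exact (TyState.reflTransGen_fnArrow ps tArrow_ne_nil hq).trans
      (TyState.reflTransGen_fnRet ps hqq')
termination_by T => sizeOf T

/-- Every nonempty parameter list is read after the parameters `done`. -/
theorem ParamState.exists_reflTransGen_out : ∀ (p : Param) (ps done : List Param) (c : Char)
    (y : List Char), p.1.1 = c :: y →
    ∃ p', ReflTransGen ParamState.Next (.name done [c]) p' ∧ p'.out = some (done ++ p :: ps)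
  | (x, T), [], done, c, y, hy => by
    obtain ⟨p', hp', ho, -⟩ := ParamState.exists_reflTransGen_name_out done x
      (TyState.exists_reflTransGen_start_out T)
    have h := ParamState.reflTransGen_name done [c] y
      (fun a ha => x.2.2 a (by dsimp only at hy; simp [hy, ha]))
    rw [List.singleton_append, ← hy] at h
    exact ⟨p', h.trans hp', ho⟩
  | (x, T), p₂ :: ps, done, c, y, hy => by
    obtain ⟨p', hp', -, hn⟩ := ParamState.exists_reflTransGen_name_out done x
      (TyState.exists_reflTransGen_start_out T)
    have h := ParamState.reflTransGen_name done [c] y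
      (fun a ha => x.2.2 a (by dsimp only at hy; simp [hy, ha]))
    rw [List.singleton_append, ← hy] at h
    -- The entries `empty` and, behind a comma, `name _ []` agree after the first character of an
    -- identifier; hence the induction starts one character into the name.
    obtain ⟨d, z, hz⟩ : ∃ d z, p₂.1.1 = d :: z := List.exists_cons_of_ne_nil p₂.1.2.1
    have hd : isWordChar d = true := p₂.1.2.2 d (by simp [hz])
    obtain ⟨p'', hp'', ho⟩ :=
      ParamState.exists_reflTransGen_out p₂ ps (done ++ [(x, T)]) d z hz
    refine ⟨p'', (h.trans hp').trans (.head hn (.head ⟨d, ?_⟩ hp'')), by simpa using ho⟩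
    simp [ParamState.step, hd]
termination_by p ps => sizeOf p + sizeOf ps

/-- Every parameter list is read by the automaton for parameter lists. -/
theorem ParamState.exists_reflTransGen_empty_out : ∀ ps : List Param,
    ∃ p', ReflTransGen ParamState.Next .empty p' ∧ p'.out = some ps
  | [] => ⟨.empty, .refl, rfl⟩
  | p :: ps => by
    obtain ⟨d, z, hz⟩ : ∃ d z, p.1.1 = d :: z := List.exists_cons_of_ne_nil p.1.2.1
    have hd : isWordChar d = true := p.1.2.2 d (by simp [hz])
    obtain ⟨p', hp', ho⟩ := ParamState.exists_reflTransGen_out p ps [] d z hz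
    exact ⟨p', .head ⟨d, by simp [ParamState.step, hd]⟩ hp', by simpa using ho⟩
termination_by ps => sizeOf ps
end

mutual
/-- Every state of the type automaton that occurs in a run leads to acceptance. -/
theorem TyState.Reads.exists_out : ∀ {q : TyState} {s : List Char}, q.Reads s →
    ∃ q' T, ReflTransGen TyState.Next q q' ∧ q'.out = some T
  | .kw T r, _, _ => ⟨_, T, TyState.reflTransGen_kw T r, rfl⟩
  | .fnOpen, _, _ => by
    obtain ⟨q, hq, q', hqq', hT⟩ := TyState.exists_reflTransGen_start_out .number
    refine ⟨.fnRet [] q', _, .head (b := .fnParams .empty) ⟨cLParen, by simp [TyState.step]⟩ ?_,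
      by simp [TyState.out, hT]; rfl⟩
    exact .head (TyState.next_fnParams rfl) ((TyState.reflTransGen_fnArrow [] tArrow_ne_nil hq).trans
      (TyState.reflTransGen_fnRet _ hqq'))
  | .fnParams p, _, h => by
    obtain ⟨t, -, h⟩ := h
    obtain ⟨p', ps, hp', hps⟩ := h.exists_out
    obtain ⟨q, hq, q', hqq', hT⟩ := TyState.exists_reflTransGen_start_out .number
    refine ⟨.fnRet ps q', _, (TyState.reflTransGen_fnParams hp').trans ?_,
      by simp [TyState.out, hT]; rfl⟩
    exact .head (TyState.next_fnParams hps) ((TyState.reflTransGen_fnArrow ps tArrow_ne_nil hq).trans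
      (TyState.reflTransGen_fnRet _ hqq'))
  | .fnArrow ps r, _, h => by
    obtain ⟨hr, -⟩ := h
    obtain ⟨q, hq, q', hqq', hT⟩ := TyState.exists_reflTransGen_start_out .number
    exact ⟨.fnRet ps q', _, (TyState.reflTransGen_fnArrow ps hr hq).trans
      (TyState.reflTransGen_fnRet _ hqq'), by simp [TyState.out, hT]; rfl⟩
  | .fnRet ps q, _, h => by
    obtain ⟨t, -, h⟩ := h
    obtain ⟨q', T, hq', hT⟩ := h.exists_out
    exact ⟨.fnRet ps q', _, TyState.reflTransGen_fnRet _ hq', by simp [TyState.out, hT]; rfl⟩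

/-- Every state of the automaton for parameter lists that occurs in a run leads to acceptance. -/
theorem ParamState.Reads.exists_out : ∀ {p : ParamState} {s : List Char}, p.Reads s →
    ∃ p' ps, ReflTransGen ParamState.Next p p' ∧ p'.out = some ps
  | .empty, _, _ => ⟨.empty, [], .refl, rfl⟩
  | .name done x, _, h => by
    -- Parameter names need not be fresh, so nothing is excluded; what matters is that the word
    -- becomes nonempty, as `x` may be empty behind a comma.
    obtain ⟨z, y, hz, hy, -⟩ := exists_fresh_ident h.1 []
    obtain ⟨p', hp', ho, -⟩ := ParamState.exists_reflTransGen_name_out done y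
      (TyState.exists_reflTransGen_start_out .number)
    have h' := ParamState.reflTransGen_name done x z hz
    rw [← hy] at h'
    exact ⟨p', _, h'.trans hp', ho⟩
  | .type done x q, _, h => by
    obtain ⟨t, -, h⟩ := h
    obtain ⟨q', T, hq', hT⟩ := h.exists_out
    exact ⟨.type done x q', _, ParamState.reflTransGen_type done x hq',
      by simp [ParamState.out, hT]; rfl⟩
end

theorem exists_mem_paramAutomaton_γ {p p' : ParamState} (h : ReflTransGen ParamState.Next p p') :
    ∃ w, p' ∈ paramAutomaton.γ [p] w :=
  paramAutomaton.exists_mem_γ_iff.2 h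

/-! ## The type search -/

namespace Heuristic
variable {L : Lang} (H : Heuristic L)

/-- An extension step that the search for `G` does not skip. -/
def Ext (G T S : Ty) : Prop := S ∈ L.extensions T ∧ H.prune T G S = false

/-- The search only succeeds along extension steps. -/
theorem reflTransGen_of_search (G : Ty) : ∀ (n : ℕ) (m : List Ty) (T : Ty),
    (H.search G n m T).1 = true → ReflTransGen (H.Ext G) T G
  | 0, m, T, h => by simp [search] at h
  | n + 1, m, T, h => by
    rw [search] at h
    split_ifs at h with h₁ h₂
    · rw [h₁]
    · refine (List.foldlRecOn (motive := fun r : Bool × List Ty =>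
        r.1 = true → ReflTransGen (H.Ext G) T G) (L.extensions T) _ (by simp) ?_) h
      intro r ih S hS hr
      split_ifs at hr with h₃ h₄
      · exact ih h₃
      · exact ih hr
      · exact .head ⟨hS, by simpa using h₄⟩ (reflTransGen_of_search G n _ S hr)

/-- A failing search, with enough depth left, marks its start and all successors of the types that
it marks, but never the goal. -/
theorem search_eq_false {G : Ty} {B : Finset Ty}
    (hB : ∀ T ∈ B, ∀ S, H.Ext G T S → S ∈ B) : ∀ (n : ℕ) (m : List Ty) (T : Ty),
    T ∈ B → m.Nodup → (∀ S ∈ m, S ∈ B) → G ∉ m → B.card < n + m.length →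
    (H.search G n m T).1 = false →
    m ⊆ (H.search G n m T).2 ∧ T ∈ (H.search G n m T).2 ∧ (H.search G n m T).2.Nodup ∧
      (∀ S ∈ (H.search G n m T).2, S ∈ B) ∧ G ∉ (H.search G n m T).2 ∧
      ∀ S ∈ (H.search G n m T).2, S ∉ m → ∀ S', H.Ext G S S' → S' ∈ (H.search G n m T).2
  | 0, m, T, _, hm, hmB, _, hn, _ => by
    -- The depth cannot run out: the marked types are distinct elements of `B`, but for `n = 0`
    -- there would be more of them than `B` has.
    have h : m.toFinset.card ≤ B.card := Finset.card_le_card fun S hS => hmB S (by simpa using hS)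
    rw [List.toFinset_card_of_nodup hm] at h
    omega
  | n + 1, m, T, hT, hm, hmB, hG, hn, h => by
    rw [search] at h ⊢
    split_ifs at h ⊢ with h₁ h₂
    · exact ⟨fun _ => id, h₂, hm, hmB, hG, fun S hS hS' => absurd hS hS'⟩
    · set f : Bool × List Ty → Ty → Bool × List Ty := fun res S =>
        if res.1 then res
        else if H.prune T G S then res
        else H.search G n res.2 S with hf
      -- the invariant of the loop, after the extensions `l` have been tried
      have key : ∀ l : List Ty, (∀ S ∈ l, S ∈ L.extensions T) →
          (l.foldl f (false, T :: m)).1 = false →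
          (T :: m) ⊆ (l.foldl f (false, T :: m)).2 ∧
          (l.foldl f (false, T :: m)).2.Nodup ∧
          (∀ S ∈ (l.foldl f (false, T :: m)).2, S ∈ B) ∧ G ∉ (l.foldl f (false, T :: m)).2 ∧
          (∀ S ∈ (l.foldl f (false, T :: m)).2, S ∉ T :: m → ∀ S', H.Ext G S S' →
            S' ∈ (l.foldl f (false, T :: m)).2) ∧
          ∀ S ∈ l, H.prune T G S = false → S ∈ (l.foldl f (false, T :: m)).2 := by
        intro l
        induction l using List.reverseRecOn with
        | nil =>
          intro _ _
          refine ⟨fun _ => id, List.nodup_cons.2 ⟨h₂, hm⟩, ?_, ?_, ?_, ?_⟩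
          · rintro S hS
            rcases List.mem_cons.1 hS with rfl | hS
            · exact hT
            · exact hmB S hS
          · intro hS
            rcases List.mem_cons.1 hS with rfl | hS
            · exact h₁ rfl
            · exact hG hS
          · exact fun S hS hS' => absurd hS hS'
          · simp
        | append_singleton l S ih =>
          intro hl hfalse
          rw [List.foldl_append, List.foldl_cons, List.foldl_nil] at hfalse ⊢
          have hS : S ∈ L.extensions T := hl S (by simp)
          have hl' : ∀ S ∈ l, S ∈ L.extensions T := fun S hS => hl S (by simp [hS])
          set r := l.foldl f (false, T :: m) with hr
          have hr1 : r.1 = false := by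
            by_contra hne
            rw [Bool.not_eq_false] at hne
            simp [hf, hne] at hfalse
          obtain ⟨a₁, a₂, a₃, a₄, a₅, a₆⟩ := ih hl' hr1
          by_cases hp : H.prune T G S = true
          · have : f r S = r := by simp [hf, hr1, hp]
            rw [this]
            refine ⟨a₁, a₂, a₃, a₄, a₅, fun S' hS' hS'p => ?_⟩
            rcases List.mem_append.1 hS' with h | h
            · exact a₆ S' h hS'p
            · obtain rfl : S' = S := by simpa using h
              simp [hp] at hS'p
          · have hfr : f r S = H.search G n r.2 S := by simp [hf, hr1, hp]
            rw [hfr] at hfalse ⊢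
            -- Marking `T` pays for the unit of depth spent on the recursive call, so the depth
            -- bound persists.
            have hlen : (T :: m).length ≤ r.2.length :=
              ((List.nodup_cons.2 ⟨h₂, hm⟩).subperm a₁).length_le
            rw [List.length_cons] at hlen
            obtain ⟨b₁, b₂, b₃, b₄, b₅, b₆⟩ := search_eq_false hB n r.2 S
              (hB T hT S ⟨hS, by simpa using hp⟩) a₂ a₃ a₄ (by omega) hfalse
            refine ⟨fun x hx => b₁ (a₁ hx), b₃, b₄, b₅, fun S₁ hS₁ hS₂ S' hS' => ?_,
              fun S' hS' hS'p => ?_⟩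
            · by_cases hr2 : S₁ ∈ r.2
              · exact b₁ (a₅ S₁ hr2 hS₂ S' hS')
              · exact b₆ S₁ hS₁ hr2 S' hS'
            · rcases List.mem_append.1 hS' with h | h
              · exact b₁ (a₆ S' h hS'p)
              · obtain rfl : S' = S := by simpa using h
                exact b₂
      obtain ⟨a₁, a₂, a₃, a₄, a₅, a₆⟩ := key (L.extensions T) (fun _ => id) h
      refine ⟨fun x hx => a₁ (by simp [hx]), a₁ (by simp), a₂, a₃, a₄, fun S hS hSm S' hS' => ?_⟩
      -- Once the loop has ended, all unskipped successors of `T` have been tried, so `T` joins the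
      -- types whose successors are marked.
      by_cases hST : S = T
      · subst hST
        exact a₆ S' hS'.1 hS'.2
      · exact a₅ S hS (by simp [hST, hSm]) S' hS'

/-- The search finds the goal iff extension steps that it does not skip lead there. -/
theorem reachable_iff {T G : Ty} :
    H.reachable T G = true ↔ ReflTransGen (H.Ext G) T G := by
  constructor
  · exact H.reflTransGen_of_search G _ _ T
  · intro h
    by_contra hne
    rw [Bool.not_eq_true] at hne
    -- With nothing marked at the start, no type is exempt: the final marks contain `T`, are closed
    -- under unskipped steps and omit `G`. Hence no path from `T` to `G` exists.
    obtain ⟨-, hT, -, -, hG, hcl⟩ := H.search_eq_false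
      (fun T' hT' S hS => H.step_mem T G T' S hT' hS.1 hS.2) _ [] T (H.self_mem T G)
      List.nodup_nil (by simp) (by simp) (by simp) hne
    have hmem : ∀ S, ReflTransGen (H.Ext G) T S →
        S ∈ (H.search G ((H.bound T G).card + 1) [] T).2 := by
      intro S hS
      induction hS with
      | refl => exact hT
      | tail _ hS ih => exact hcl _ ih (by simp) _ hS
    exact hG (hmem G h)

theorem reachable_self (T : Ty) : H.reachable T T = true := H.reachable_iff.2 .refl

end Heuristic

/-! ## Runs of the expression automaton -/

/-- The literal automaton can be in the given state after the given string. -/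
def LitState.Reads : LitState → List Char → Prop
  | .num₀, s => s = []
  | .num₁, s => s ≠ [] ∧ ∀ c ∈ s, c.isDigit = true
  | .str₀, s => s = []
  | .str₁, s => ∃ t, IsWord t ∧ s = cQuote :: t
  | .str₂, s => ∃ t, IsWord t ∧ s = [cQuote] ++ t ++ [cQuote]
  | .bool r, s => ∃ b : Bool, s ++ r = if b then tTrue else tFalse

theorem LitState.reads_start {q : LitState} (h : q ∈ LitState.start) : q.Reads [] := by
  simp only [LitState.start, List.mem_cons, List.not_mem_nil, or_false] at h
  rcases h with rfl | rfl | rfl | rfl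
  · rfl
  · rfl
  · exact ⟨true, rfl⟩
  · exact ⟨false, rfl⟩

theorem LitState.Reads.step {q : LitState} {s : List Char} {c : Char} (h : q.Reads s)
    {q' : LitState} (hq : q' ∈ q.step c) : q'.Reads (s ++ [c]) := by
  cases q with
  | num₀ =>
    obtain rfl : s = [] := h
    simp only [LitState.step] at hq
    split_ifs at hq with hc
    · obtain rfl : q' = .num₁ := by simpa using hq
      exact ⟨by simp, by simpa using hc⟩
    · simp at hq
  | num₁ =>
    simp only [LitState.step] at hq
    split_ifs at hq with hc
    · obtain rfl : q' = .num₁ := by simpa using hq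
      refine ⟨by simp, fun a ha => ?_⟩
      rcases List.mem_append.1 ha with ha | ha
      · exact h.2 a ha
      · obtain rfl : a = c := by simpa using ha
        exact hc
    · simp at hq
  | str₀ =>
    obtain rfl : s = [] := h
    simp only [LitState.step] at hq
    split_ifs at hq with hc
    · obtain rfl : q' = .str₁ := by simpa using hq
      exact ⟨[], by simp [IsWord], by simp [hc]⟩
    · simp at hq
  | str₁ =>
    obtain ⟨t, ht, rfl⟩ := h
    simp only [LitState.step, List.mem_append] at hq
    rcases hq with hq | hq
    · split_ifs at hq with hc
      · obtain rfl : q' = .str₁ := by simpa using hq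
        exact ⟨t ++ [c], ht.append_singleton hc, by simp⟩
      · simp at hq
    · split_ifs at hq with hc
      · obtain rfl : q' = .str₂ := by simpa using hq
        exact ⟨t, ht, by simp [hc]⟩
      · simp at hq
  | str₂ => simp [LitState.step] at hq
  | bool r =>
    obtain ⟨b, h⟩ := h
    rw [LitState.step, mem_eat] at hq
    obtain ⟨r', rfl, ⟨rfl, hq⟩ | ⟨-, rfl⟩⟩ := hq
    · obtain rfl : q' = .bool [] := by simpa using hq
      exact ⟨b, by simpa using h⟩
    · exact ⟨b, by simpa using h⟩

/-- The text of expressions with a comma behind each of them. -/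
def argsPrefix (es : List Expr) : List Char := es.flatMap (fun e => e.text ++ [cComma])

theorem argsPrefix_append_singleton (es : List Expr) (e : Expr) :
    argsPrefix (es ++ [e]) = argsPrefix es ++ (e.text ++ [cComma]) := by
  simp [argsPrefix]

theorem argsText_append_singleton (es : List Expr) (e : Expr) :
    Expr.argsText (es ++ [e]) = argsPrefix es ++ e.text := by
  induction es with
  | nil => simp [argsPrefix, Expr.argsText]
  | cons a es ih =>
    obtain ⟨b, es', h⟩ : ∃ b es', es ++ [e] = b :: es' := by
      cases es <;> simp
    rw [List.cons_append, h, Expr.argsText, ← h, ih]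
    simp [argsPrefix]

theorem Lang.ArgsHaveType.append_singleton {L : Lang} {Γ : Env} {es : List Expr} {Ts : List Ty}
    {e : Expr} {T : Ty} (h : L.ArgsHaveType Γ es Ts) (he : L.HasType Γ e T) :
    L.ArgsHaveType Γ (es ++ [e]) (Ts ++ [T]) := by
  induction es generalizing Ts with
  | nil =>
    cases h
    exact .cons _ _ _ _ _ he (.nil _)
  | cons a es ih =>
    cases h with
    | cons _ _ _ _ _ ha hes => exact .cons _ _ _ _ _ ha (ih hes)

namespace ExprState
variable {L : Lang} (H : Heuristic L)

/-- The expression automaton in the environment `Γ` can be in the given state after the given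
string. -/
def Reads (Γ : Env) : ExprState → List Char → Prop
  | .lit q, s => q.Reads s
  | .ident T r, s => ∃ x : Ident, (x, T) ∈ Γ ∧ s ++ r = x.1
  | .groupOpen, s => s = []
  | .groupIn q, s => ∃ t, s = cLParen :: t ∧ Reads Γ q t
  | .groupDone T, s => ∃ e, L.HasType Γ e T ∧ e.text = s
  | .anonOpen, s => s = []
  | .anonParams p, s => ∃ t, s = cLParen :: t ∧ p.Reads t
  | .anonArrow ps r, s => r ≠ [] ∧
      ∃ t, t ++ r = tArrow ∧ s = [cLParen] ++ Ty.paramsText ps ++ [cRParen] ++ t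
  | .anonBody ps q, s => ∃ t, s = [cLParen] ++ Ty.paramsText ps ++ [cRParen] ++ tArrow ++ t ∧
      Reads (Γ.extendParams ps) q t
  | .opSym R S r, s => r ≠ [] ∧ ∃ e T, ∃ o : OpSym, ∃ t, L.HasType Γ e T ∧ (o, R, S) ∈ L.ops T ∧
      t ++ r = o.1 ∧ s = e.text ++ t
  -- That the inner state can reach `R` must be remembered explicitly: the set derivable from the
  -- whole state is just `{S}` and tells nothing about the operand. For a group this is not needed,
  -- since its derivable set is computed from the inner state.
  | .opArg R S q, s => H.CanReach R q ∧ ∃ e T, ∃ o : OpSym, ∃ t, L.HasType Γ e T ∧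
      (o, R, S) ∈ L.ops T ∧ s = e.text ++ o.1 ++ t ∧ Reads Γ q t
  | .callOpen Rs S, s => ∃ f ps, L.HasType Γ f (.fn ps S) ∧ ps.map Prod.snd = Rs ∧ s = f.text
  | .callNil S, s => ∃ f, L.HasType Γ f (.fn [] S) ∧ s = f.text ++ [cLParen]
  | .callArg R Rs S q, s => H.CanReach R q ∧ ∃ f ps es Ts t, L.HasType Γ f (.fn ps S) ∧
      L.ArgsHaveType Γ es Ts ∧ ps.map Prod.snd = Ts ++ R :: Rs ∧
      s = f.text ++ [cLParen] ++ argsPrefix es ++ t ∧ Reads Γ q t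
  | .callDone S, s => ∃ e, L.HasType Γ e S ∧ e.text = s
  | .mem S r, s => ∃ e T, ∃ n : Ident, ∃ t, L.HasType Γ e T ∧ L.lookup T n = some S ∧
      t ++ r = cDot :: n.1 ∧ s = e.text ++ t

theorem reads_start {Γ : Env} {q : ExprState} (h : q ∈ start Γ) : q.Reads H Γ [] := by
  simp only [start, List.mem_append, List.mem_map, List.mem_singleton] at h
  rcases h with ((⟨q, hq, rfl⟩ | ⟨⟨x, T⟩, hx, rfl⟩) | rfl) | rfl
  · exact LitState.reads_start hq
  · exact ⟨x, hx, rfl⟩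
  · rfl
  · rfl

/-- The string read in an accepting state is the text of an expression of the state's type. -/
theorem Reads.exists_expr : ∀ {q : ExprState} {Γ : Env} {s : List Char} {T : Ty},
    q.Reads H Γ s → q.typ = some T → ∃ e, L.HasType Γ e T ∧ e.text = s
  | .lit q, Γ, s, T, h, ht => by
    simp only [typ] at ht
    split_ifs at ht with ha
    cases ht
    cases q with
    | num₀ => simp [LitState.accepts] at ha
    | num₁ => exact ⟨.num ⟨s, h⟩, .num _ _, by simp [Expr.text]⟩
    | str₀ => simp [LitState.accepts] at ha
    | str₁ => simp [LitState.accepts] at ha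
    | str₂ =>
      obtain ⟨t, ht, rfl⟩ := h
      exact ⟨.str ⟨t, ht⟩, .str _ _, by simp [Expr.text]⟩
    | bool r =>
      obtain ⟨b, h⟩ := h
      cases r with
      | nil => exact ⟨.bool b, .bool _ _, by simpa [Expr.text] using h.symm⟩
      | cons => simp [LitState.accepts] at ha
  | .ident T' [], Γ, s, T, h, ht => by
    obtain rfl : T' = T := by simpa [typ] using ht
    obtain ⟨x, hx, h⟩ := h
    exact ⟨.var x, .ident _ _ _ hx, by simpa [Expr.text] using h.symm⟩
  | .groupDone T', Γ, s, T, h, ht => by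
    obtain rfl : T' = T := by simpa [typ] using ht
    exact h
  | .anonBody ps q, Γ, s, T, h, ht => by
    obtain ⟨t, rfl, h⟩ := h
    simp only [typ, Option.map_eq_some_iff] at ht
    obtain ⟨R, hR, rfl⟩ := ht
    obtain ⟨e, he, rfl⟩ := h.exists_expr hR
    exact ⟨.anon ps e, .anon _ _ _ _ he, by simp [Expr.text]⟩
  | .opArg R S q, Γ, s, T, h, ht => by
    obtain ⟨-, e, T', o, t, he, ho, rfl, h⟩ := h
    simp only [typ] at ht
    split_ifs at ht with hR
    cases ht
    obtain ⟨e', he', rfl⟩ := h.exists_expr hR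
    exact ⟨.op e o e', .op _ _ _ _ _ _ _ he he' ho, by simp [Expr.text]⟩
  | .callDone S, Γ, s, T, h, ht => by
    obtain rfl : S = T := by simpa [typ] using ht
    exact h
  | .mem S [], Γ, s, T, h, ht => by
    obtain rfl : S = T := by simpa [typ] using ht
    obtain ⟨e, T, n, t, he, hn, h, rfl⟩ := h
    rw [List.append_nil] at h
    exact ⟨.member e n, .member _ _ _ _ _ he hn, by simp [Expr.text, h]⟩
  | .ident _ (_ :: _), _, _, _, _, ht => by simp [typ] at ht
  | .groupOpen, _, _, _, _, ht => by simp [typ] at ht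
  | .groupIn _, _, _, _, _, ht => by simp [typ] at ht
  | .anonOpen, _, _, _, _, ht => by simp [typ] at ht
  | .anonParams _, _, _, _, _, ht => by simp [typ] at ht
  | .anonArrow _ _, _, _, _, _, ht => by simp [typ] at ht
  | .opSym _ _ _, _, _, _, _, ht => by simp [typ] at ht
  | .callOpen _ _, _, _, _, _, ht => by simp [typ] at ht
  | .callNil _, _, _, _, _, ht => by simp [typ] at ht
  | .callArg _ _ _ _, _, _, _, _, ht => by simp [typ] at ht
  | .mem _ (_ :: _), _, _, _, _, ht => by simp [typ] at ht

/-- The initial states of the extensions of an expression continue its text. -/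
theorem reads_extStart {Γ : Env} {e : Expr} {T : Ty} (he : L.HasType Γ e T) {q : ExprState}
    (hq : q ∈ extStart L T) : q.Reads H Γ e.text := by
  simp only [extStart, List.mem_append, List.mem_map, List.mem_filterMap,
    Option.map_eq_some_iff] at hq
  rcases hq with (⟨⟨o, R, S⟩, ho, rfl⟩ | hq) | ⟨n, -, S, hS, rfl⟩
  · exact ⟨o.2, e, T, o, [], he, ho, rfl, by simp⟩
  · split at hq
    · obtain rfl := List.mem_singleton.1 hq
      exact ⟨e, _, he, rfl, rfl⟩
    · simp at hq
  · exact ⟨e, T, n, [], he, hS, rfl, by simp⟩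

variable [∀ G : Ty, DecidablePred (H.CanReach G)]

theorem mem_restrict {G : Ty} {qs : List ExprState} {q : ExprState} :
    q ∈ restrict H G qs ↔ q ∈ qs ∧ H.CanReach G q := by
  simp [restrict]

theorem mem_startAt {Γ : Env} {G : Ty} {q : ExprState} :
    q ∈ startAt H Γ G ↔ q ∈ start Γ ∧ H.CanReach G q :=
  mem_restrict H

theorem mem_stepAt {Γ : Env} {G : Ty} {q q' : ExprState} {c : Char} :
    q' ∈ stepAt H Γ G q c ↔ q' ∈ step H Γ q c ∧ H.CanReach G q' :=
  mem_restrict H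

variable {H} in
theorem Reads.leafStep {q : ExprState} {Γ : Env} {s : List Char} {c : Char} (h : q.Reads H Γ s)
    {q' : ExprState} (hq : q' ∈ leafStep H Γ q c) : q'.Reads H Γ (s ++ [c]) := by
  cases q with
  | lit q =>
    obtain ⟨p, hp, rfl⟩ := List.mem_map.1 hq
    exact LitState.Reads.step h hp
  | ident T r =>
    obtain ⟨x, hx, h⟩ := h
    rw [ExprState.leafStep, mem_eat] at hq
    obtain ⟨r', rfl, ⟨rfl, hq⟩ | ⟨-, rfl⟩⟩ := hq
    · obtain rfl := List.mem_singleton.1 hq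
      exact ⟨x, hx, by simpa using h⟩
    · exact ⟨x, hx, by simpa using h⟩
  | groupOpen =>
    obtain rfl : s = [] := h
    simp only [ExprState.leafStep] at hq
    split_ifs at hq with hc
    · obtain ⟨p, hp, rfl⟩ := List.mem_map.1 hq
      exact ⟨[], by simp [hc], reads_start H hp⟩
    · simp at hq
  | anonOpen =>
    obtain rfl : s = [] := h
    simp only [ExprState.leafStep] at hq
    split_ifs at hq with hc
    · obtain rfl := List.mem_singleton.1 hq
      exact ⟨[], by simp [hc], rfl⟩
    · simp at hq
  | anonParams p =>
    obtain ⟨t, rfl, h⟩ := h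
    simp only [ExprState.leafStep, List.mem_append, List.mem_map] at hq
    rcases hq with ⟨p', hp', rfl⟩ | hq
    · exact ⟨t ++ [c], by simp, h.step p' hp'⟩
    · split at hq
      · rename_i ps hps
        split_ifs at hq with hc
        · obtain rfl := List.mem_singleton.1 hq
          exact ⟨tArrow_ne_nil, [], rfl, by simp [hc, ParamState.text_of_out h hps]⟩
        · simp at hq
      · simp at hq
  | anonArrow ps r =>
    obtain ⟨-, t, ht, rfl⟩ := h
    rw [ExprState.leafStep, mem_eat] at hq
    obtain ⟨r', rfl, ⟨rfl, hq⟩ | ⟨hr', rfl⟩⟩ := hq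
    · obtain ⟨p, hp, rfl⟩ := List.mem_map.1 hq
      exact ⟨[], by simp [← ht], reads_start H hp⟩
    · exact ⟨hr', t ++ [c], by simp [← ht], by simp⟩
  | opSym R S r =>
    obtain ⟨-, e, T, o, t, he, ho, ht, rfl⟩ := h
    rw [ExprState.leafStep, mem_eat] at hq
    obtain ⟨r', rfl, ⟨rfl, hq⟩ | ⟨hr', rfl⟩⟩ := hq
    · obtain ⟨p, hp, rfl⟩ := List.mem_map.1 hq
      rw [mem_startAt] at hp
      exact ⟨hp.2, e, T, o, [], he, ho, by simp [← ht], reads_start H hp.1⟩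
    · exact ⟨hr', e, T, o, t ++ [c], he, ho, by simp [← ht], by simp⟩
  | callOpen Rs S =>
    obtain ⟨f, ps, hf, hps, rfl⟩ := h
    simp only [ExprState.leafStep] at hq
    split_ifs at hq with hc
    · cases Rs with
      | nil =>
        obtain rfl := List.mem_singleton.1 hq
        obtain rfl := List.map_eq_nil_iff.1 hps
        exact ⟨f, hf, by simp [hc]⟩
      | cons R Rs =>
        obtain ⟨p, hp, rfl⟩ := List.mem_map.1 hq
        rw [mem_startAt] at hp
        exact ⟨hp.2, f, ps, [], [], [], hf, .nil _, hps, by simp [hc, argsPrefix],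
          reads_start H hp.1⟩
    · simp at hq
  | callNil S =>
    obtain ⟨f, hf, rfl⟩ := h
    simp only [ExprState.leafStep] at hq
    split_ifs at hq with hc
    · obtain rfl := List.mem_singleton.1 hq
      exact ⟨.call f [], .call _ _ _ _ _ hf (.nil _), by simp [Expr.text, Expr.argsText, hc]⟩
    · simp at hq
  | mem S r =>
    obtain ⟨e, T, n, t, he, hn, ht, rfl⟩ := h
    rw [ExprState.leafStep, mem_eat] at hq
    obtain ⟨r', rfl, ⟨rfl, hq⟩ | ⟨hr', rfl⟩⟩ := hq
    · obtain rfl := List.mem_singleton.1 hq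
      exact ⟨e, T, n, t ++ [c], he, hn, by simp [← ht], by simp⟩
    · exact ⟨e, T, n, t ++ [c], he, hn, by simp [← ht], by simp⟩
  | groupIn q => simp [ExprState.leafStep] at hq
  | groupDone T => simp [ExprState.leafStep] at hq
  | anonBody ps q => simp [ExprState.leafStep] at hq
  | opArg R S q => simp [ExprState.leafStep] at hq
  | callArg R Rs S q => simp [ExprState.leafStep] at hq
  | callDone S => simp [ExprState.leafStep] at hq

-- An accepting state has read a complete expression of its type. The initial states of the
-- extensions satisfy the invariant for that same text, as they have read nothing further, so this
-- reduces to `Reads.leafStep`.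
variable {H} in
theorem Reads.extStep {q : ExprState} {Γ : Env} {s : List Char} {c : Char} (h : q.Reads H Γ s)
    {q' : ExprState} (hq : q' ∈ extStep H Γ q c) : q'.Reads H Γ (s ++ [c]) := by
  unfold ExprState.extStep at hq
  split at hq
  · rename_i T hT
    obtain ⟨e, he, rfl⟩ := h.exists_expr H hT
    obtain ⟨p, hp, hq⟩ := List.mem_flatMap.1 hq
    exact (reads_extStart H he hp).leafStep hq
  · simp at hq

variable {H} in
theorem Reads.leafStep_append_extStep {q : ExprState} {Γ : Env} {s : List Char} {c : Char}
    (h : q.Reads H Γ s) {q' : ExprState}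
    (hq : q' ∈ ExprState.leafStep H Γ q c ++ ExprState.extStep H Γ q c) :
    q'.Reads H Γ (s ++ [c]) :=
  (List.mem_append.1 hq).elim h.leafStep h.extStep

variable {H} in
theorem Reads.step : ∀ {q : ExprState} {Γ : Env} {s : List Char} {c : Char}, q.Reads H Γ s →
    ∀ q' ∈ step H Γ q c, q'.Reads H Γ (s ++ [c])
  | .groupIn q, Γ, s, c, h, q', hq => by
    obtain ⟨t, rfl, h⟩ := h
    simp only [ExprState.step, List.mem_append, List.mem_map] at hq
    rcases hq with ⟨p, hp, rfl⟩ | hq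
    · exact ⟨t ++ [c], by simp, h.step p hp⟩
    · split at hq
      · rename_i T hT
        split_ifs at hq with hc
        · obtain rfl := List.mem_singleton.1 hq
          obtain ⟨e, he, rfl⟩ := h.exists_expr H hT
          exact ⟨.group e, .group _ _ _ he, by simp [Expr.text, hc]⟩
        · simp at hq
      · simp at hq
  | .anonBody ps q, Γ, s, c, h, q', hq => by
    simp only [ExprState.step, List.mem_append, List.mem_map] at hq
    rcases hq with ⟨p, hp, rfl⟩ | hq
    · obtain ⟨t, rfl, h⟩ := h
      exact ⟨t ++ [c], by simp, h.step p hp⟩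
    · exact h.extStep hq
  | .opArg R S q, Γ, s, c, h, q', hq => by
    simp only [ExprState.step, List.mem_append, List.mem_map, mem_restrict] at hq
    rcases hq with ⟨p, ⟨hp, hR⟩, rfl⟩ | hq
    · obtain ⟨-, e, T, o, t, he, ho, rfl, h⟩ := h
      exact ⟨hR, e, T, o, t ++ [c], he, ho, by simp, h.step p hp⟩
    · exact h.extStep hq
  | .callArg R Rs S q, Γ, s, c, h, q', hq => by
    obtain ⟨-, f, ps, es, Ts, t, hf, hes, hps, rfl, h⟩ := h
    simp only [ExprState.step, List.mem_append, List.mem_map, mem_restrict] at hq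
    rcases hq with ⟨p, ⟨hp, hR⟩, rfl⟩ | hq
    · exact ⟨hR, f, ps, es, Ts, t ++ [c], hf, hes, hps, by simp, h.step p hp⟩
    · by_cases hT : q.typ = some R
      · rw [if_pos hT] at hq
        obtain ⟨e, he, rfl⟩ := h.exists_expr H hT
        have hes' := hes.append_singleton he
        cases Rs with
        | nil =>
          dsimp only at hq
          split_ifs at hq with hc
          · obtain rfl := List.mem_singleton.1 hq
            -- With no later argument, the parameter types are exactly those of the finished
            -- arguments followed by `R`.
            exact ⟨.call f (es ++ [e]), .call _ _ _ _ _ hf (hps ▸ hes'),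
              by simp [Expr.text, argsText_append_singleton, hc]⟩
          · simp at hq
        | cons R' Rs =>
          dsimp only at hq
          split_ifs at hq with hc
          · obtain ⟨p, hp, rfl⟩ := List.mem_map.1 hq
            rw [mem_startAt] at hp
            exact ⟨hp.2, f, ps, es ++ [e], Ts ++ [R], [], hf, hes', by simpa using hps,
              by simp [argsPrefix_append_singleton, hc], reads_start H hp.1⟩
          · simp at hq
      · simp [hT] at hq
  | .lit _, _, _, _, h, _, hq => h.leafStep_append_extStep hq
  | .ident _ _, _, _, _, h, _, hq => h.leafStep_append_extStep hq
  | .groupOpen, _, _, _, h, _, hq => h.leafStep_append_extStep hq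
  | .groupDone _, _, _, _, h, _, hq => h.leafStep_append_extStep hq
  | .anonOpen, _, _, _, h, _, hq => h.leafStep_append_extStep hq
  | .anonParams _, _, _, _, h, _, hq => h.leafStep_append_extStep hq
  | .anonArrow _ _, _, _, _, h, _, hq => h.leafStep_append_extStep hq
  | .opSym _ _ _, _, _, _, h, _, hq => h.leafStep_append_extStep hq
  | .callOpen _ _, _, _, _, h, _, hq => h.leafStep_append_extStep hq
  | .callNil _, _, _, _, h, _, hq => h.leafStep_append_extStep hq
  | .callDone _, _, _, _, h, _, hq => h.leafStep_append_extStep hq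
  | .mem _ _, _, _, _, h, _, hq => h.leafStep_append_extStep hq

end ExprState

/-! ## Completions in the expression automaton -/

namespace ExprState
variable {L : Lang} (H : Heuristic L)

theorem mem_derivable_anonParams {p p' : ParamState} {ps : List Param}
    (h : ReflTransGen ParamState.Next p p') (hp : p'.out = some ps) (R : Ty) :
    Ty.fn ps R ∈ H.derivable (.anonParams p) := by
  obtain ⟨w, hw⟩ := exists_mem_paramAutomaton_γ h
  exact ⟨w, p', hw, ps, R, hp, rfl⟩

/-- Some type is derivable from every state that occurs in a run. -/
theorem Reads.exists_mem_derivable : ∀ {q : ExprState} {Γ : Env} {s : List Char},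
    q.Reads H Γ s → ∃ D, D ∈ H.derivable q
  | .lit q, _, _, _ => ⟨q.type, rfl⟩
  | .ident T _, _, _, _ => ⟨T, rfl⟩
  | .groupOpen, _, _, _ => ⟨.number, trivial⟩
  | .groupIn q, _, _, h => by
    obtain ⟨t, -, h⟩ := h
    obtain ⟨D, hD⟩ := h.exists_mem_derivable
    exact ⟨D, D, hD, H.reachable_self D⟩
  | .groupDone T, _, _, _ => ⟨T, rfl⟩
  | .anonOpen, _, _, _ => ⟨.fn [] .number, [], .number, rfl⟩
  | .anonParams p, _, _, h => by
    obtain ⟨t, -, h⟩ := h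
    obtain ⟨p', ps, hp, ho⟩ := h.exists_out
    exact ⟨_, mem_derivable_anonParams H hp ho .number⟩
  | .anonArrow ps _, _, _, _ => ⟨.fn ps .number, .number, rfl⟩
  | .anonBody ps q, _, _, h => by
    obtain ⟨t, -, h⟩ := h
    obtain ⟨D, hD⟩ := h.exists_mem_derivable
    exact ⟨.fn ps D, D, rfl, D, hD, H.reachable_self D⟩
  | .opSym _ S _, _, _, _ => ⟨S, rfl⟩
  | .opArg _ S _, _, _, _ => ⟨S, rfl⟩
  | .callOpen _ S, _, _, _ => ⟨S, rfl⟩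
  | .callNil S, _, _, _ => ⟨S, rfl⟩
  | .callArg _ _ S _, _, _, _ => ⟨S, rfl⟩
  | .callDone S, _, _, _ => ⟨S, rfl⟩
  | .mem S _, _, _, _ => ⟨S, rfl⟩

/-- Used for expression statements, which prescribe no type: a derivable type serves as its own
goal, with a search of no steps. -/
theorem Reads.exists_canReach {q : ExprState} {Γ : Env} {s : List Char} (h : q.Reads H Γ s) :
    ∃ D, H.CanReach D q := by
  obtain ⟨D, hD⟩ := h.exists_mem_derivable
  exact ⟨D, D, hD, H.reachable_self D⟩

variable [∀ G : Ty, DecidablePred (H.CanReach G)]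

/-- Some character leads from `q` to `q'` in the automaton restricted to the type `G`. -/
def Next (Γ : Env) (G : Ty) (q q' : ExprState) : Prop := ∃ c, q' ∈ stepAt H Γ G q c

/-- The automaton restricted to the type `G` leads from `q` to the end of an expression of
type `T`. -/
def Completes (Γ : Env) (G : Ty) (q : ExprState) (T : Ty) : Prop :=
  ∃ q', ReflTransGen (Next H Γ G) q q' ∧ q'.typ = some T

/-- An initial state of the automaton restricted to the type `T` leads to the end of an expression
of this type. -/
def Inhabited (Γ : Env) (T : Ty) : Prop := ∃ q ∈ startAt H Γ T, Completes H Γ T q T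

variable {H} {Γ : Env} {G : Ty}

theorem Completes.head {q q' : ExprState} {T : Ty} (h : Next H Γ G q q')
    (h' : Completes H Γ G q' T) : Completes H Γ G q T := by
  obtain ⟨p, hp, hT⟩ := h'
  exact ⟨p, .head h hp, hT⟩

theorem Completes.trans {q q' : ExprState} {T : Ty} (h : ReflTransGen (Next H Γ G) q q')
    (h' : Completes H Γ G q' T) : Completes H Γ G q T := by
  obtain ⟨p, hp, hT⟩ := h'
  exact ⟨p, h.trans hp, hT⟩

theorem Next.of_step {q q' : ExprState} {c : Char} (h : q' ∈ step H Γ q c)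
    (h' : H.CanReach G q') : Next H Γ G q q' := ⟨c, (mem_stepAt H).2 ⟨h, h'⟩⟩

theorem mem_step_of_mem_leafStep {q q' : ExprState} {c : Char} (h : q' ∈ leafStep H Γ q c) :
    q' ∈ step H Γ q c := by
  cases q <;> first
    | exact List.mem_append_left _ h
    | simp [leafStep] at h

/-- `step` omits the extensions only for `groupIn` and `callArg`, and these states never accept. -/
theorem mem_step_of_mem_extStep {q q' : ExprState} {c : Char} (h : q' ∈ extStep H Γ q c) :
    q' ∈ step H Γ q c := by
  cases q <;> first
    | exact List.mem_append_right _ h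
    | simp [extStep, typ] at h

theorem Next.of_leafStep {q q' : ExprState} {c : Char} (h : q' ∈ leafStep H Γ q c)
    (h' : H.CanReach G q') : Next H Γ G q q' := .of_step (mem_step_of_mem_leafStep h) h'

/-- A terminal in an expression can be read to its end. -/
theorem Completes.eat {more : List Char → ExprState} {next : List ExprState} {S T : Ty}
    (hS : ∀ r, S ∈ H.derivable (more r)) (hSG : H.reachable S G = true)
    (hstep : ∀ r c, leafStep H Γ (more r) c = _root_.eat r c more next) {q : ExprState}
    (hq : q ∈ next) (hG : H.CanReach G q) (h : Completes H Γ G q T) {r : List Char}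
    (hr : r ≠ []) : Completes H Γ G (more r) T := by
  refine .trans (reflTransGen_of_eat (more := more) (fun a r hr => ?_) (fun a => ?_) hr) h
  · exact .of_leafStep (c := a) (by simp [hstep, mem_eat, hr]) ⟨S, hS r, hSG⟩
  · exact .of_leafStep (c := a) (by simp [hstep, mem_eat, hq]) hG

/-- The inner expression has its own goal `T`. An inner state from which the search finds `T` makes
`T` derivable from the group, and `T` reaches `G`, so the outer filter keeps it. The two searches
must stay separate: skipping depends on the goal, so reaching `T` and then `G` need not mean that
`G` is found directly. -/
theorem Completes.groupIn {q : ExprState} {T : Ty} (hT : H.reachable T G = true)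
    (h : Completes H Γ T q T) : Completes H Γ G (.groupIn q) T := by
  obtain ⟨q', hq', ht⟩ := h
  refine .trans (q' := .groupIn q') (hq'.lift _ fun a b ⟨c, hc⟩ => ?_)
    ⟨.groupDone T, .single (.of_step (c := cRParen) (by simp [step, ht]) ⟨T, rfl, hT⟩), rfl⟩
  rw [mem_stepAt] at hc
  exact .of_step (c := c) (by simp [step, hc.1]) ⟨T, hc.2, hT⟩

theorem Completes.anonBody {ps : List Param} {q : ExprState} {R : Ty}
    (hR : H.reachable (.fn ps R) G = true) (h : Completes H (Γ.extendParams ps) R q R) :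
    Completes H Γ G (.anonBody ps q) (.fn ps R) := by
  obtain ⟨q', hq', ht⟩ := h
  refine .trans (q' := .anonBody ps q') (hq'.lift _ fun a b ⟨c, hc⟩ => ?_)
    ⟨_, .refl, by simp [typ, ht]⟩
  rw [mem_stepAt] at hc
  exact .of_step (c := c) (by simp [step, hc.1]) ⟨_, ⟨R, rfl, hc.2⟩, hR⟩

/-- Two filters apply. The inner one, for `R`, is passed by the given completion; the outer one
always sees the result type `S`. -/
theorem Completes.opArg {q : ExprState} {R S : Ty} (hS : H.reachable S G = true)
    (h : Completes H Γ R q R) : Completes H Γ G (.opArg R S q) S := by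
  obtain ⟨q', hq', ht⟩ := h
  refine .trans (q' := .opArg R S q') (hq'.lift _ fun a b ⟨c, hc⟩ => ?_)
    ⟨_, .refl, by simp [typ, ht]⟩
  rw [mem_stepAt] at hc
  exact .of_step (c := c) (by simp [step, mem_restrict, hc.1, hc.2]) ⟨S, rfl, hS⟩

theorem reflTransGen_callArg {q q' : ExprState} {R S : Ty} (Rs : List Ty)
    (hS : H.reachable S G = true) (h : ReflTransGen (Next H Γ R) q q') :
    ReflTransGen (Next H Γ G) (.callArg R Rs S q) (.callArg R Rs S q') := by
  refine h.lift _ fun a b ⟨c, hc⟩ => ?_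
  rw [mem_stepAt] at hc
  exact .of_step (c := c) (by simp [step, mem_restrict, hc.1, hc.2]) ⟨S, rfl, hS⟩

theorem Completes.anonArrow {ps : List Param} {r : List Char} {R : Ty} (hr : r ≠ [])
    (hR : H.reachable (.fn ps R) G = true) (h : Inhabited H (Γ.extendParams ps) R) :
    Completes H Γ G (.anonArrow ps r) (.fn ps R) := by
  obtain ⟨q, hq, hc⟩ := h
  rw [mem_startAt] at hq
  exact .eat (S := .fn ps R) (more := .anonArrow ps) (fun r => ⟨R, rfl⟩) hR (fun _ _ => rfl)
    (List.mem_map_of_mem hq.1) ⟨_, ⟨R, rfl, hq.2⟩, hR⟩ (hc.anonBody hR) hr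

/-- Every state on the path to `p'` still leads to the parameter list `ps`, so the same function
type remains derivable throughout and no state is filtered out. -/
theorem Completes.anonParams {p p' : ParamState} {ps : List Param} {R : Ty}
    (hp : ReflTransGen ParamState.Next p p') (ho : p'.out = some ps)
    (hR : H.reachable (.fn ps R) G = true) (h : Inhabited H (Γ.extendParams ps) R) :
    Completes H Γ G (.anonParams p) (.fn ps R) := by
  induction hp using ReflTransGen.head_induction_on with
  | refl =>
    refine .head (.of_leafStep (c := cRParen) (q' := .anonArrow ps tArrow) ?_ ⟨_, ⟨R, rfl⟩, hR⟩)
      (.anonArrow tArrow_ne_nil hR h)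
    simp [leafStep, ho]
  | head hn hp ih =>
    obtain ⟨c, hc⟩ := hn
    exact .head (.of_leafStep (c := c) (by simp [leafStep, hc])
      ⟨_, mem_derivable_anonParams H hp ho R, hR⟩) ih

theorem Completes.anonOpen {ps : List Param} {R : Ty} (hR : H.reachable (.fn ps R) G = true)
    (h : Inhabited H (Γ.extendParams ps) R) : Completes H Γ G .anonOpen (.fn ps R) := by
  obtain ⟨p, hp, ho⟩ := ParamState.exists_reflTransGen_empty_out ps
  exact .head (.of_leafStep (c := cLParen) (by simp [leafStep])
    ⟨_, mem_derivable_anonParams H hp ho R, hR⟩) (.anonParams hp ho hR h)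

theorem Completes.lit {q : LitState} {s : List Char} (hq : q.Reads s)
    (hG : H.reachable q.type G = true) : Completes H Γ G (.lit q) q.type := by
  cases q with
  | num₀ =>
    exact .head (q' := .lit .num₁) (.of_leafStep (c := Char.ofNat 48)
      (by simp [leafStep, LitState.step]) ⟨_, rfl, hG⟩) ⟨_, .refl, rfl⟩
  | num₁ => exact ⟨_, .refl, rfl⟩
  | str₀ =>
    refine .head (q' := .lit .str₁) (.of_leafStep (c := cQuote)
      (by simp [leafStep, LitState.step]) ⟨_, rfl, hG⟩) ?_
    exact .head (q' := .lit .str₂) (.of_leafStep (c := cQuote)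
      (by simp [leafStep, LitState.step]) ⟨_, rfl, hG⟩) ⟨_, .refl, rfl⟩
  | str₁ =>
    exact .head (q' := .lit .str₂) (.of_leafStep (c := cQuote)
      (by simp [leafStep, LitState.step]) ⟨_, rfl, hG⟩) ⟨_, .refl, rfl⟩
  | str₂ => exact ⟨_, .refl, rfl⟩
  | bool r =>
    cases r with
    | nil => exact ⟨_, .refl, rfl⟩
    | cons a r =>
      refine .trans (q' := .lit (.bool [])) (reflTransGen_of_eat
        (more := fun r => ExprState.lit (.bool r)) (r := a :: r)
        (fun a r hr => ?_) (fun a => ?_) (by simp)) ⟨_, .refl, rfl⟩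
      · exact .of_leafStep (c := a) (by simp [leafStep, LitState.step, mem_eat, hr]) ⟨_, rfl, hG⟩
      · exact .of_leafStep (c := a) (by simp [leafStep, LitState.step, mem_eat]) ⟨_, rfl, hG⟩

variable (H) in
/-- There are expressions of every type. -/
theorem inhabited : ∀ (T : Ty) (Γ : Env), Inhabited H Γ T
  | .number, Γ => ⟨.lit .num₀, (mem_startAt H).2 ⟨by simp [start, LitState.start],
      _, rfl, H.reachable_self _⟩, .lit (s := []) rfl (H.reachable_self .number)⟩
  | .string, Γ => ⟨.lit .str₀, (mem_startAt H).2 ⟨by simp [start, LitState.start],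
      _, rfl, H.reachable_self _⟩, .lit (s := []) rfl (H.reachable_self .string)⟩
  | .boolean, Γ => ⟨.lit (.bool tTrue), (mem_startAt H).2 ⟨by simp [start, LitState.start],
      _, rfl, H.reachable_self _⟩, .lit (s := []) ⟨true, rfl⟩ (H.reachable_self .boolean)⟩
  -- A function literal whose body inhabits the result type; the recursion is on the type, for all
  -- environments at once, as the body lives in an extended one.
  | .fn ps R, Γ => ⟨.anonOpen, (mem_startAt H).2 ⟨by simp [start],
      _, ⟨ps, R, rfl⟩, H.reachable_self _⟩, .anonOpen (H.reachable_self _) (inhabited R _)⟩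
termination_by T => sizeOf T

theorem Completes.ident {T : Ty} (hT : H.reachable T G = true) :
    ∀ r, Completes H Γ G (.ident T r) T
  | [] => ⟨_, .refl, rfl⟩
  | a :: r => .eat (S := T) (more := .ident T) (fun _ => rfl) hT (fun _ _ => rfl)
      (List.mem_singleton_self _) ⟨T, rfl, hT⟩ ⟨_, .refl, rfl⟩ (by simp)

theorem Completes.mem {S : Ty} (hS : H.reachable S G = true) :
    ∀ r, Completes H Γ G (.mem S r) S
  | [] => ⟨_, .refl, rfl⟩
  | a :: r => .eat (S := S) (more := .mem S) (fun _ => rfl) hS (fun _ _ => rfl)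
      (List.mem_singleton_self _) ⟨S, rfl, hS⟩ ⟨_, .refl, rfl⟩ (by simp)

theorem Completes.opSym {R S : Ty} (hS : H.reachable S G = true) {r : List Char} (hr : r ≠ []) :
    Completes H Γ G (.opSym R S r) S := by
  obtain ⟨q, hq, hc⟩ := inhabited H R Γ
  exact .eat (S := S) (more := .opSym R S) (fun _ => rfl) hS (fun _ _ => rfl)
    (List.mem_map_of_mem hq) ⟨S, rfl, hS⟩ (hc.opArg hS) hr

theorem Completes.callNil {S : Ty} (hS : H.reachable S G = true) :
    Completes H Γ G (.callNil S) S :=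
  .head (q' := .callDone S) (.of_leafStep (c := cRParen) (by simp [leafStep]) ⟨S, rfl, hS⟩)
    ⟨_, .refl, rfl⟩

/-- Later arguments are filled with arbitrary expressions of the required types. Meanwhile the outer
filter only sees the return type `S`. -/
theorem Completes.callArg {S : Ty} (hS : H.reachable S G = true) : ∀ {R : Ty} {q : ExprState}
    (Rs : List Ty), Completes H Γ R q R → Completes H Γ G (.callArg R Rs S q) S
  | R, q, [], h => by
    obtain ⟨q', hq', ht⟩ := h
    exact .trans (reflTransGen_callArg [] hS hq') (.head (q' := .callDone S)
      (.of_step (c := cRParen) (by simp [step, ht]) ⟨S, rfl, hS⟩) ⟨_, .refl, rfl⟩)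
  | R, q, R' :: Rs, h => by
    obtain ⟨q', hq', ht⟩ := h
    obtain ⟨p, hp, hc⟩ := inhabited H R' Γ
    exact .trans (reflTransGen_callArg (R' :: Rs) hS hq') (.head (q' := .callArg R' Rs S p)
      (.of_step (c := cComma) (by simp [step, ht, hp]) ⟨S, rfl, hS⟩) (callArg hS Rs hc))

theorem Completes.callOpen {S : Ty} (hS : H.reachable S G = true) :
    ∀ Rs, Completes H Γ G (.callOpen Rs S) S
  | [] => .head (q' := .callNil S)
      (.of_leafStep (c := cLParen) (by simp [leafStep, callArgs]) ⟨S, rfl, hS⟩) (.callNil hS)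
  | R :: Rs => by
    obtain ⟨p, hp, hc⟩ := inhabited H R Γ
    exact .head (q' := .callArg R Rs S p)
      (.of_leafStep (c := cLParen) (by simp [leafStep, callArgs, hp]) ⟨S, rfl, hS⟩)
      (.callArg hS Rs hc)

/-- Every extension step of types is performed by an extension. -/
theorem exists_extStart_completes {T S : Ty} (h : S ∈ L.extensions T)
    (hS : H.reachable S G = true) (Γ : Env) :
    ∃ q ∈ extStart L T, q.typ = none ∧ (∀ c, step H Γ q c = leafStep H Γ q c) ∧
      Completes H Γ G q S := by
  simp only [Lang.extensions, List.mem_append, List.mem_map, List.mem_filterMap] at h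
  rcases h with (⟨⟨o, R, S'⟩, ho, rfl⟩ | h) | ⟨n, hn, hl⟩
  · refine ⟨.opSym R S' o.1, ?_, rfl, fun c => by simp [step, extStep, typ], .opSym hS o.2⟩
    simp only [extStart, List.mem_append, List.mem_map]
    exact .inl (.inl ⟨_, ho, rfl⟩)
  · split at h
    · rename_i ps R
      obtain rfl := List.mem_singleton.1 h
      exact ⟨.callOpen (ps.map Prod.snd) S, by simp [extStart], rfl,
        fun c => by simp [step, extStep, typ], .callOpen hS _⟩
    · simp at h
  · refine ⟨.mem S (cDot :: n.1), ?_, rfl, fun c => by simp [step, extStep, typ], .mem hS _⟩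
    simp only [extStart, List.mem_append, List.mem_filterMap, Option.map_eq_some_iff]
    exact .inr ⟨n, hn, S, hl, rfl⟩

/-- The initial state `p` of an extension is never entered; the accepting state takes over its first
transition. As `p` does not accept, its completion has a first transition, and that one belongs to
`leafStep`. -/
theorem Completes.extend {q : ExprState} {T S : Ty} (hq : q.typ = some T)
    (h : S ∈ L.extensions T) (hS : H.reachable S G = true) : Completes H Γ G q S := by
  obtain ⟨p, hp, hn, hstep, p', hpp', hS'⟩ := exists_extStart_completes h hS Γ
  rcases hpp'.cases_head with rfl | ⟨p₁, ⟨c, hc⟩, hp₁⟩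
  · simp [hn] at hS'
  · rw [mem_stepAt, hstep] at hc
    refine .head (.of_step (c := c) (mem_step_of_mem_extStep ?_) hc.2) ⟨p', hp₁, hS'⟩
    simp only [extStep, hq, List.mem_flatMap]
    exact ⟨p, hp, hc.1⟩

/-- An expression can be extended as found by the type search. -/
theorem Completes.extend_of_reachable {q : ExprState} {T : Ty} (h : Completes H Γ G q T)
    (hT : H.reachable T G = true) : Completes H Γ G q G := by
  rw [Heuristic.reachable_iff] at hT
  induction hT using ReflTransGen.head_induction_on with
  | refl => exact h
  | head hS hG ih =>
    obtain ⟨q', hq', ht⟩ := h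
    -- The remaining path `hG` witnesses that the search still finds `G` from the result of this
    -- extension, which keeps the states of the extension alive.
    exact ih (.trans hq' (.extend ht hS.1 ((H.reachable_iff).2 hG)))

/-- If the type search finds `G` from a type derivable from the state `q`, then the automaton
restricted to `G` leads from `q` to acceptance. -/
theorem Reads.completes : ∀ {q : ExprState} {Γ : Env} {G : Ty} {s : List Char}, q.Reads H Γ s →
    H.CanReach G q → Completes H Γ G q G
  | .lit q, Γ, G, s, h, ⟨_, rfl, hG⟩ => (Completes.lit h hG).extend_of_reachable hG
  | .ident T r, Γ, G, s, h, ⟨_, rfl, hG⟩ => (Completes.ident hG r).extend_of_reachable hG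
  -- Every type counts as derivable before the parenthesis, so the given witness carries no
  -- information; the group is filled with an expression of type `G` itself.
  | .groupOpen, Γ, G, s, h, _ => by
    obtain ⟨q, hq, hc⟩ := inhabited H G Γ
    rw [mem_startAt] at hq
    exact .head (q' := .groupIn q) (.of_leafStep (c := cLParen) (by simp [ExprState.leafStep, hq.1])
      ⟨G, hq.2, H.reachable_self G⟩) (hc.groupIn (H.reachable_self G))
  -- The inner state is completed for `T` by recursion; extensions behind the closing parenthesis
  -- then lead from `T` to `G`.
  | .groupIn q, Γ, G, s, ⟨t, _, h⟩, ⟨T, hT, hG⟩ =>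
    ((h.completes hT).groupIn hG).extend_of_reachable hG
  | .groupDone T, Γ, G, s, h, ⟨_, rfl, hG⟩ => .extend_of_reachable ⟨_, .refl, rfl⟩ hG
  | .anonOpen, Γ, G, s, h, ⟨_, ⟨ps, R, rfl⟩, hG⟩ =>
    (Completes.anonOpen hG (inhabited H R _)).extend_of_reachable hG
  | .anonParams p, Γ, G, s, h, ⟨_, ⟨w, p', hp', ps, R, ho, rfl⟩, hG⟩ =>
    (Completes.anonParams (paramAutomaton.exists_mem_γ_iff.1 ⟨w, hp'⟩) ho hG
      (inhabited H R _)).extend_of_reachable hG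
  | .anonArrow ps r, Γ, G, s, h, ⟨_, ⟨R, rfl⟩, hG⟩ =>
    (Completes.anonArrow h.1 hG (inhabited H R _)).extend_of_reachable hG
  | .anonBody ps q, Γ, G, s, ⟨t, _, h⟩, ⟨_, ⟨R, rfl, hR⟩, hG⟩ =>
    ((h.completes hR).anonBody hG).extend_of_reachable hG
  | .opSym R S r, Γ, G, s, h, ⟨_, rfl, hG⟩ => (Completes.opSym hG h.1).extend_of_reachable hG
  | .opArg R S q, Γ, G, s, ⟨hR, _, _, _, _, _, _, _, h⟩, ⟨_, rfl, hG⟩ =>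
    ((h.completes hR).opArg hG).extend_of_reachable hG
  | .callOpen Rs S, Γ, G, s, h, ⟨_, rfl, hG⟩ => (Completes.callOpen hG Rs).extend_of_reachable hG
  | .callNil S, Γ, G, s, h, ⟨_, rfl, hG⟩ => (Completes.callNil hG).extend_of_reachable hG
  | .callArg R Rs S q, Γ, G, s, ⟨hR, _, _, _, _, _, _, _, _, _, h⟩, ⟨_, rfl, hG⟩ =>
    ((h.completes hR).callArg hG Rs).extend_of_reachable hG
  | .callDone S, Γ, G, s, h, ⟨_, rfl, hG⟩ => .extend_of_reachable ⟨_, .refl, rfl⟩ hG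
  | .mem S r, Γ, G, s, h, ⟨_, rfl, hG⟩ => (Completes.mem hG r).extend_of_reachable hG

end ExprState

/-! ## Runs of the automata for statements and programs -/

-- Return values of sequences that grow on the right

namespace Lang
variable {L : Lang}

theorem Returns.append {Γ : Env} {ss : List Stmt} {R : Ty} (h : L.Returns Γ ss R)
    (ss' : List Stmt) : L.Returns Γ (ss ++ ss') R := by
  induction h with
  | decl Γ x T ss R _ ih => exact .decl _ _ _ _ _ ih
  | expr Γ e ss R _ ih => exact .expr _ _ _ _ ih
  | ret Γ e ss R he => exact .ret _ _ _ _ he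
  | block_self Γ bs ss R h _ => exact .block_self _ _ _ _ h
  | block_next Γ bs ss R _ ih => exact .block_next _ _ _ _ ih
  | func Γ x ps R' body ss R hb _ _ ih => exact .func _ _ _ _ _ _ _ hb ih
  | ite_self Γ e s₁ s₂ ss R h₁ h₂ _ _ => exact .ite_self _ _ _ _ _ _ h₁ h₂
  | ite_next Γ e s₁ s₂ ss R _ ih => exact .ite_next _ _ _ _ _ _ ih

theorem SeqOk.append_singleton {ρ : Option Ty} {Γ Γ₁ Γ₂ : Env} {ss : List Stmt} {s : Stmt}
    (h : L.SeqOk ρ Γ ss Γ₁) (hs : L.StmtOk ρ Γ₁ s Γ₂) : L.SeqOk ρ Γ (ss ++ [s]) Γ₂ := by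
  induction ss generalizing Γ with
  | nil =>
    cases h
    exact .seq _ _ _ _ _ _ hs (.nop _ _)
  | cons a ss ih =>
    cases h with
    | seq _ _ _ _ _ _ ha h => exact .seq _ _ _ _ _ _ ha (ih h)

/-- A returning statement makes every well-typed sequence return that it is appended to. -/
theorem SeqOk.returns_append {R : Ty} {Γ Γ₁ : Env} {ss ss' : List Stmt}
    (h : L.SeqOk (some R) Γ ss Γ₁) (hs : L.Returns Γ₁ ss' R) : L.Returns Γ (ss ++ ss') R := by
  induction ss generalizing Γ with
  | nil =>
    cases h
    exact hs
  | cons a ss ih =>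
    cases h with
    | seq _ _ _ _ _ _ ha h =>
      cases ha with
      | decl _ _ _ _ _ => exact .decl _ _ _ _ _ (ih h)
      | expr _ _ _ _ _ => exact .expr _ _ _ _ (ih h)
      -- The judgement has no rule that skips a return statement, but none is needed: well-typedness
      -- within a function of return type `R` gives this earlier one the type `R` already.
      | ret _ _ _ he => exact .ret _ _ _ _ he
      | block _ _ _ _ _ => exact .block_next _ _ _ _ (ih h)
      | func _ _ _ _ _ _ _ _ _ hr => exact .func _ _ _ _ _ _ _ hr (ih h)
      | ite _ _ _ _ _ _ _ _ _ _ => exact .ite_next _ _ _ _ _ _ (ih h)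

/-- If the flag `r` is set, then the statements ensure a return value of the type required by the
surrounding function. -/
def ReturnsIf (L : Lang) (ρ : Option Ty) (Γ : Env) (ss : List Stmt) (r : Bool) : Prop :=
  r = true → ∃ R, ρ = some R ∧ L.Returns Γ ss R

/-- If the flag was set before, later statements do no harm; if the new statement sets it, the
well-typedness of the earlier ones is needed to pass over them. -/
theorem ReturnsIf.append_singleton {ρ : Option Ty} {Γ Γ₁ : Env} {ss : List Stmt} {s : Stmt}
    {r r' : Bool} (hss : L.SeqOk ρ Γ ss Γ₁) (h : L.ReturnsIf ρ Γ ss r)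
    (h' : L.ReturnsIf ρ Γ₁ [s] r') : L.ReturnsIf ρ Γ (ss ++ [s]) (r || r') := by
  intro hr
  rcases (Bool.or_eq_true _ _).mp hr with hr | hr
  · obtain ⟨R, hR, h⟩ := h hr
    exact ⟨R, hR, h.append _⟩
  · obtain ⟨R, rfl, hR⟩ := h' hr
    exact ⟨R, rfl, hss.returns_append hR⟩

end Lang

theorem Stmt.seqText_append_singleton (ss : List Stmt) (s : Stmt) :
    Stmt.seqText (ss ++ [s]) = Stmt.seqText ss ++ s.text := by
  induction ss with
  | nil => simp [Stmt.seqText]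
  | cons a ss ih => simp [Stmt.seqText, ih]

-- The invariant of the statement automata

section
variable {L : Lang} (H : Heuristic L)

mutual
/-- The statement automaton in the environment `Γ` and with return type `ρ` can be in the given
state after the given string. -/
def StmtState.Reads (Γ : Env) (ρ : Option Ty) : StmtState → List Char → Prop
  | .declKw r, s => r ≠ [] ∧ s ++ r = tLet
  | .declName x, s => IsWord x ∧ s = tLet ++ x
  | .declType x q, s => Γ.Fresh x ∧ ∃ t, s = tLet ++ x.1 ++ [cColon] ++ t ∧ q.Reads t
  | .declDone x T, s => Γ.Fresh x ∧ s = (Stmt.decl x T).text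
  | .exprIn q, s => q.Reads H Γ s
  | .exprDone, s => ∃ e T, L.HasType Γ e T ∧ s = (Stmt.expr e).text
  | .retKw r, s => ρ.isSome = true ∧ r ≠ [] ∧ s ++ r = tReturn
  | .retIn R q, s => ρ = some R ∧ H.CanReach R q ∧ ∃ t, s = tReturn ++ t ∧ q.Reads H Γ t
  | .retDone, s => ∃ e R, ρ = some R ∧ L.HasType Γ e R ∧ s = (Stmt.ret e).text
  | .blockOpen, s => s = []
  | .blockIn q, s => ∃ t, s = cLBrace :: t ∧ SeqState.Reads ρ Γ q t
  | .blockDone r, s => ∃ ss Γ', L.SeqOk ρ Γ ss Γ' ∧ L.ReturnsIf ρ Γ ss r ∧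
      s = (Stmt.block ss).text
  | .funcKw r, s => r ≠ [] ∧ s ++ r = tFunction
  | .funcName x, s => IsWord x ∧ s = tFunction ++ x
  | .funcParams x p, s => Γ.Fresh x ∧ ∃ t, s = tFunction ++ x.1 ++ [cLParen] ++ t ∧ p.Reads t
  | .funcColon x ps, s => Γ.Fresh x ∧
      s = tFunction ++ x.1 ++ [cLParen] ++ Ty.paramsText ps ++ [cRParen]
  | .funcType x ps q, s => Γ.Fresh x ∧ ∃ t, s = tFunction ++ x.1 ++ [cLParen] ++
      Ty.paramsText ps ++ [cRParen] ++ [cColon] ++ t ∧ q.Reads t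
  | .funcBody x ps R q, s => Γ.Fresh x ∧ ∃ t, s = tFunction ++ x.1 ++ [cLParen] ++
      Ty.paramsText ps ++ [cRParen] ++ [cColon] ++ R.text ++ [cLBrace] ++ t ∧
      SeqState.Reads (some R) ((Γ.extend x (.fn ps R)).extendParams ps) q t
  | .funcDone x ps R, s => ∃ body, L.StmtOk ρ Γ (.func x ps R body) (Γ.extend x (.fn ps R)) ∧
      s = (Stmt.func x ps R body).text
  | .iteKw r, s => r ≠ [] ∧ s ++ r = tIf
  | .iteCond q, s => H.CanReach .boolean q ∧ ∃ t, s = tIf ++ t ∧ q.Reads H Γ t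
  | .iteBlank, s => ∃ e, L.HasType Γ e .boolean ∧ s = tIf ++ e.text ++ [cRParen]
  | .iteThen q, s => ∃ e t, L.HasType Γ e .boolean ∧
      s = tIf ++ e.text ++ [cRParen, cBlank] ++ t ∧ StmtState.Reads Γ ρ q t
  | .iteElseKw r l, s => l ≠ [] ∧ ∃ e s₁ Γ₁ t, L.HasType Γ e .boolean ∧ L.StmtOk ρ Γ s₁ Γ₁ ∧
      L.ReturnsIf ρ Γ [s₁] r ∧ t ++ l = tElse ∧
      s = tIf ++ e.text ++ [cRParen, cBlank] ++ s₁.text ++ [cBlank] ++ t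
  | .iteElse r q, s => ∃ e s₁ Γ₁ t, L.HasType Γ e .boolean ∧ L.StmtOk ρ Γ s₁ Γ₁ ∧
      L.ReturnsIf ρ Γ [s₁] r ∧
      s = tIf ++ e.text ++ [cRParen, cBlank] ++ s₁.text ++ [cBlank] ++ tElse ++ t ∧
      StmtState.Reads Γ ρ q t

/-- The automaton for sequences of statements, started in the environment `Γ` and with return type
`ρ`, can be in the given state after the given string. -/
def SeqState.Reads (ρ : Option Ty) (Γ : Env) : SeqState → List Char → Prop
  -- `init` occurs only before the first character; later statements begin directly in `inside`.
  -- Thus its environment and flag are the original ones.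
  | .init Γ' r, s => s = [] ∧ Γ' = Γ ∧ r = false
  | .inside Γ' r q, s => ∃ ss t, L.SeqOk ρ Γ ss Γ' ∧ L.ReturnsIf ρ Γ ss r ∧
      s = Stmt.seqText ss ++ t ∧ StmtState.Reads Γ' ρ q t
end

theorem StmtState.reads_start {Γ : Env} {ρ : Option Ty} {q : StmtState} (h : q ∈ start Γ ρ) :
    q.Reads H Γ ρ [] := by
  simp only [start, List.mem_append, List.mem_map, List.mem_singleton] at h
  rcases h with ((((rfl | ⟨q, hq, rfl⟩) | h) | rfl) | rfl) | rfl
  · exact ⟨by simp [tLet, chars], rfl⟩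
  · exact ExprState.reads_start H hq
  · split at h
    · obtain rfl := List.mem_singleton.1 h
      exact ⟨rfl, by simp [tReturn, chars], rfl⟩
    · simp at h
  · rfl
  · exact ⟨by simp [tFunction, chars], rfl⟩
  · exact ⟨by simp [tIf, chars], rfl⟩

/-- The string read in an accepting state is the text of a well-typed statement, with the
environment and the flag that the state yields. -/
theorem StmtState.Reads.exists_stmt : ∀ {q : StmtState} {Γ : Env} {ρ : Option Ty} {s : List Char}
    {o : Env × Bool}, q.Reads H Γ ρ s → StmtState.out Γ q = some o →
    ∃ st, L.StmtOk ρ Γ st o.1 ∧ L.ReturnsIf ρ Γ [st] o.2 ∧ st.text = s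
  | .declDone x T, Γ, ρ, s, o, ⟨hx, hs⟩, ho => by
    cases ho
    exact ⟨_, .decl _ _ _ _ hx, by simp [Lang.ReturnsIf], hs.symm⟩
  | .exprDone, Γ, ρ, s, o, ⟨e, T, he, hs⟩, ho => by
    cases ho
    exact ⟨_, .expr _ _ _ _ he, by simp [Lang.ReturnsIf], hs.symm⟩
  | .retDone, Γ, ρ, s, o, ⟨e, R, hR, he, hs⟩, ho => by
    cases ho
    subst hR
    exact ⟨_, .ret _ _ _ he, fun _ => ⟨R, rfl, .ret _ _ _ _ he⟩, hs.symm⟩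
  | .blockDone r, Γ, ρ, s, o, ⟨ss, Γ', hss, hr, hs⟩, ho => by
    cases ho
    refine ⟨_, .block _ _ _ _ hss, fun h => ?_, hs.symm⟩
    obtain ⟨R, hR, h⟩ := hr h
    exact ⟨R, hR, .block_self _ _ _ _ h⟩
  | .funcDone x ps R, Γ, ρ, s, o, ⟨body, hf, hs⟩, ho => by
    cases ho
    exact ⟨_, hf, by simp [Lang.ReturnsIf], hs.symm⟩
  | .iteElse r q, Γ, ρ, s, o, ⟨e, s₁, Γ₁, t, he, h₁, hr, hs, h⟩, ho => by
    simp only [StmtState.out, Option.map_eq_some_iff] at ho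
    obtain ⟨o', ho', rfl⟩ := ho
    obtain ⟨s₂, h₂, hr', rfl⟩ := h.exists_stmt ho'
    refine ⟨.ite e s₁ s₂, .ite _ _ _ _ _ _ _ he h₁ h₂, fun hb => ?_, by simp [Stmt.text, hs]⟩
    obtain ⟨hb₁, hb₂⟩ := (Bool.and_eq_true _ _).mp hb
    obtain ⟨R, rfl, hR₁⟩ := hr hb₁
    obtain ⟨R', hR', hR₂⟩ := hr' hb₂
    -- Both branches return the type declared by the same surrounding function, so their types
    -- agree.
    cases hR'
    exact ⟨R, rfl, .ite_self _ _ _ _ _ _ hR₁ hR₂⟩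
  | .declKw _, _, _, _, _, _, ho => by simp [StmtState.out] at ho
  | .declName _, _, _, _, _, _, ho => by simp [StmtState.out] at ho
  | .declType _ _, _, _, _, _, _, ho => by simp [StmtState.out] at ho
  | .exprIn _, _, _, _, _, _, ho => by simp [StmtState.out] at ho
  | .retKw _, _, _, _, _, _, ho => by simp [StmtState.out] at ho
  | .retIn _ _, _, _, _, _, _, ho => by simp [StmtState.out] at ho
  | .blockOpen, _, _, _, _, _, ho => by simp [StmtState.out] at ho
  | .blockIn _, _, _, _, _, _, ho => by simp [StmtState.out] at ho
  | .funcKw _, _, _, _, _, _, ho => by simp [StmtState.out] at ho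
  | .funcName _, _, _, _, _, _, ho => by simp [StmtState.out] at ho
  | .funcParams _ _, _, _, _, _, _, ho => by simp [StmtState.out] at ho
  | .funcColon _ _, _, _, _, _, _, ho => by simp [StmtState.out] at ho
  | .funcType _ _ _, _, _, _, _, _, ho => by simp [StmtState.out] at ho
  | .funcBody _ _ _ _, _, _, _, _, _, ho => by simp [StmtState.out] at ho
  | .iteKw _, _, _, _, _, _, ho => by simp [StmtState.out] at ho
  | .iteCond _, _, _, _, _, _, ho => by simp [StmtState.out] at ho
  | .iteBlank, _, _, _, _, _, ho => by simp [StmtState.out] at ho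
  | .iteThen _, _, _, _, _, _, ho => by simp [StmtState.out] at ho
  | .iteElseKw _ _, _, _, _, _, _, ho => by simp [StmtState.out] at ho

/-- The string read in an accepting state is the text of a well-typed sequence of statements, with
the environment and the flag that the state yields. -/
theorem SeqState.Reads.exists_stmts {q : SeqState} {Γ : Env} {ρ : Option Ty} {s : List Char}
    {o : Env × Bool} (h : q.Reads H ρ Γ s) (ho : q.out = some o) :
    ∃ ss, L.SeqOk ρ Γ ss o.1 ∧ L.ReturnsIf ρ Γ ss o.2 ∧ Stmt.seqText ss = s := by
  cases q with
  | init Γ' r =>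
    obtain ⟨rfl, rfl, rfl⟩ := h
    cases ho
    exact ⟨[], .nop _ _, by simp [Lang.ReturnsIf], rfl⟩
  | inside Γ' r q =>
    obtain ⟨ss, t, hss, hr, rfl, h⟩ := h
    simp only [SeqState.out, Option.map_eq_some_iff] at ho
    obtain ⟨o', ho', rfl⟩ := ho
    obtain ⟨st, hst, hr', rfl⟩ := h.exists_stmt H ho'
    exact ⟨ss ++ [st], hss.append_singleton hst, hr.append_singleton hss hr',
      Stmt.seqText_append_singleton ss st⟩

variable [∀ G : Ty, DecidablePred (H.CanReach G)]

variable {H} in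
theorem StmtState.Reads.leafStep {q : StmtState} {Γ : Env} {ρ : Option Ty} {s : List Char}
    {c : Char} (h : q.Reads H Γ ρ s) {q' : StmtState} (hq : q' ∈ leafStep H Γ ρ q c) :
    q'.Reads H Γ ρ (s ++ [c]) := by
  cases q with
  | declKw r =>
    obtain ⟨-, h⟩ := h
    rw [StmtState.leafStep, mem_eat] at hq
    obtain ⟨r', rfl, ⟨rfl, hq⟩ | ⟨hr', rfl⟩⟩ := hq
    · obtain rfl := List.mem_singleton.1 hq
      exact ⟨by simp [IsWord], by simp [h]⟩
    · exact ⟨hr', by simp [h]⟩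
  | declName x =>
    obtain ⟨hx, rfl⟩ := h
    simp only [StmtState.leafStep, List.mem_append] at hq
    rcases hq with hq | hq
    · split_ifs at hq with hc
      · obtain rfl := List.mem_singleton.1 hq
        exact ⟨hx.append_singleton hc, by simp⟩
      · simp at hq
    · split at hq
      · rename_i y hy
        split_ifs at hq with hc
        · obtain ⟨p, hp, rfl⟩ := List.mem_map.1 hq
          exact ⟨hc.2, [], by simp [hc.1, toIdent_eq_some.1 hy], TyState.reads_start hp⟩
        · simp at hq
      · simp at hq
  | declType x q =>
    obtain ⟨hx, t, rfl, h⟩ := h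
    simp only [StmtState.leafStep, List.mem_append, List.mem_map] at hq
    rcases hq with ⟨p, hp, rfl⟩ | hq
    · exact ⟨hx, t ++ [c], by simp, h.step p hp⟩
    · split at hq
      · rename_i T hT
        split_ifs at hq with hc
        · obtain rfl := List.mem_singleton.1 hq
          exact ⟨hx, by simp [Stmt.text, hc, TyState.text_of_out h hT]⟩
        · simp at hq
      · simp at hq
  | exprIn q =>
    simp only [StmtState.leafStep, List.mem_append, List.mem_map] at hq
    rcases hq with ⟨p, hp, rfl⟩ | hq
    · exact ExprState.Reads.step h p hp
    · split_ifs at hq with hc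
      · obtain rfl := List.mem_singleton.1 hq
        obtain ⟨T, hT⟩ := Option.isSome_iff_exists.1 hc.1
        obtain ⟨e, he, rfl⟩ := ExprState.Reads.exists_expr H h hT
        exact ⟨e, T, he, by simp [Stmt.text, hc.2]⟩
      · simp at hq
  | retKw r =>
    obtain ⟨hρ, -, h⟩ := h
    obtain ⟨R, rfl⟩ := Option.isSome_iff_exists.1 hρ
    simp only [StmtState.leafStep, mem_eat] at hq
    obtain ⟨r', rfl, ⟨rfl, hq⟩ | ⟨hr', rfl⟩⟩ := hq
    · obtain ⟨p, hp, rfl⟩ := List.mem_map.1 hq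
      rw [ExprState.mem_startAt] at hp
      exact ⟨rfl, hp.2, [], by simp [h], ExprState.reads_start H hp.1⟩
    · exact ⟨rfl, hr', by simp [h]⟩
  | retIn R q =>
    obtain ⟨hR, -, t, rfl, h⟩ := h
    simp only [StmtState.leafStep, List.mem_append, List.mem_map, ExprState.mem_stepAt] at hq
    rcases hq with ⟨p, ⟨hp, hp'⟩, rfl⟩ | hq
    · exact ⟨hR, hp', t ++ [c], by simp, h.step p hp⟩
    · split_ifs at hq with hc
      · obtain rfl := List.mem_singleton.1 hq
        obtain ⟨e, he, rfl⟩ := h.exists_expr H hc.1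
        exact ⟨e, R, hR, he, by simp [Stmt.text, hc.2]⟩
      · simp at hq
  | blockOpen =>
    obtain rfl : s = [] := h
    simp only [StmtState.leafStep] at hq
    split_ifs at hq with hc
    · obtain rfl := List.mem_singleton.1 hq
      exact ⟨[], by simp [hc], rfl, rfl, rfl⟩
    · simp at hq
  | funcKw r =>
    obtain ⟨-, h⟩ := h
    rw [StmtState.leafStep, mem_eat] at hq
    obtain ⟨r', rfl, ⟨rfl, hq⟩ | ⟨hr', rfl⟩⟩ := hq
    · obtain rfl := List.mem_singleton.1 hq
      exact ⟨by simp [IsWord], by simp [h]⟩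
    · exact ⟨hr', by simp [h]⟩
  | funcName x =>
    obtain ⟨hx, rfl⟩ := h
    simp only [StmtState.leafStep, List.mem_append] at hq
    rcases hq with hq | hq
    · split_ifs at hq with hc
      · obtain rfl := List.mem_singleton.1 hq
        exact ⟨hx.append_singleton hc, by simp⟩
      · simp at hq
    · split at hq
      · rename_i y hy
        split_ifs at hq with hc
        · obtain rfl := List.mem_singleton.1 hq
          exact ⟨hc.2, [], by simp [hc.1, toIdent_eq_some.1 hy], rfl⟩
        · simp at hq
      · simp at hq
  | funcParams x p =>
    obtain ⟨hx, t, rfl, h⟩ := h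
    simp only [StmtState.leafStep, List.mem_append, List.mem_map] at hq
    rcases hq with ⟨p', hp', rfl⟩ | hq
    · exact ⟨hx, t ++ [c], by simp, h.step p' hp'⟩
    · split at hq
      · rename_i ps hps
        split_ifs at hq with hc
        · obtain rfl := List.mem_singleton.1 hq
          exact ⟨hx, by simp [hc, ParamState.text_of_out h hps]⟩
        · simp at hq
      · simp at hq
  | funcColon x ps =>
    obtain ⟨hx, rfl⟩ := h
    simp only [StmtState.leafStep] at hq
    split_ifs at hq with hc
    · obtain ⟨p, hp, rfl⟩ := List.mem_map.1 hq
      exact ⟨hx, [], by simp [hc], TyState.reads_start hp⟩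
    · simp at hq
  | funcType x ps q =>
    obtain ⟨hx, t, rfl, h⟩ := h
    simp only [StmtState.leafStep, List.mem_append, List.mem_map] at hq
    rcases hq with ⟨p, hp, rfl⟩ | hq
    · exact ⟨hx, t ++ [c], by simp, h.step p hp⟩
    · split at hq
      · rename_i R hR
        split_ifs at hq with hc
        · obtain rfl := List.mem_singleton.1 hq
          exact ⟨hx, [], by simp [hc, TyState.text_of_out h hR], rfl, rfl, rfl⟩
        · simp at hq
      · simp at hq
  | iteKw r =>
    obtain ⟨-, h⟩ := h
    rw [StmtState.leafStep, mem_eat] at hq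
    obtain ⟨r', rfl, ⟨rfl, hq⟩ | ⟨hr', rfl⟩⟩ := hq
    · obtain ⟨p, hp, rfl⟩ := List.mem_map.1 hq
      rw [ExprState.mem_startAt] at hp
      exact ⟨hp.2, [], by simp [h], ExprState.reads_start H hp.1⟩
    · exact ⟨hr', by simp [h]⟩
  | iteCond q =>
    obtain ⟨-, t, rfl, h⟩ := h
    simp only [StmtState.leafStep, List.mem_append, List.mem_map, ExprState.mem_stepAt] at hq
    rcases hq with ⟨p, ⟨hp, hp'⟩, rfl⟩ | hq
    · exact ⟨hp', t ++ [c], by simp, h.step p hp⟩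
    · split_ifs at hq with hc
      · obtain rfl := List.mem_singleton.1 hq
        obtain ⟨e, he, rfl⟩ := h.exists_expr H hc.1
        exact ⟨e, he, by simp [hc.2]⟩
      · simp at hq
  | iteBlank =>
    obtain ⟨e, he, rfl⟩ := h
    simp only [StmtState.leafStep] at hq
    split_ifs at hq with hc
    · obtain ⟨p, hp, rfl⟩ := List.mem_map.1 hq
      exact ⟨e, [], he, by simp [hc], StmtState.reads_start H hp⟩
    · simp at hq
  | iteElseKw r l =>
    obtain ⟨-, e, s₁, Γ₁, t, he, h₁, hr, ht, rfl⟩ := h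
    rw [StmtState.leafStep, mem_eat] at hq
    obtain ⟨l', rfl, ⟨rfl, hq⟩ | ⟨hl', rfl⟩⟩ := hq
    · obtain ⟨p, hp, rfl⟩ := List.mem_map.1 hq
      exact ⟨e, s₁, Γ₁, [], he, h₁, hr, by simp [← ht], StmtState.reads_start H hp⟩
    · exact ⟨hl', e, s₁, Γ₁, t ++ [c], he, h₁, hr, by simp [← ht], by simp⟩
  | declDone x T => simp [StmtState.leafStep] at hq
  | exprDone => simp [StmtState.leafStep] at hq
  | retDone => simp [StmtState.leafStep] at hq
  | blockIn q => simp [StmtState.leafStep] at hq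
  | blockDone r => simp [StmtState.leafStep] at hq
  | funcBody x ps R q => simp [StmtState.leafStep] at hq
  | funcDone x ps R => simp [StmtState.leafStep] at hq
  | iteThen q => simp [StmtState.leafStep] at hq
  | iteElse r q => simp [StmtState.leafStep] at hq

theorem StmtState.reads_startStep {Γ : Env} {ρ : Option Ty} {c : Char} {q : StmtState}
    (h : q ∈ StmtState.startStep H Γ ρ c) : q.Reads H Γ ρ [c] := by
  obtain ⟨p, hp, hq⟩ := List.mem_flatMap.1 h
  exact (StmtState.reads_start H hp).leafStep hq

variable {H}

mutual
theorem StmtState.Reads.step : ∀ {q : StmtState} {Γ : Env} {ρ : Option Ty} {s : List Char}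
    {c : Char}, q.Reads H Γ ρ s → ∀ q' ∈ StmtState.step H Γ ρ q c, q'.Reads H Γ ρ (s ++ [c])
  | .blockIn q, Γ, ρ, s, c, ⟨t, hs, h⟩, q', hq => by
    subst hs
    simp only [StmtState.step, List.mem_append, List.mem_map] at hq
    rcases hq with ⟨p, hp, rfl⟩ | hq
    · exact ⟨t ++ [c], by simp, h.step p hp⟩
    · split at hq
      · rename_i o ho
        split_ifs at hq with hc
        · obtain rfl := List.mem_singleton.1 hq
          obtain ⟨ss, hss, hr, rfl⟩ := h.exists_stmts H ho
          exact ⟨ss, o.1, hss, hr, by simp [Stmt.text, hc]⟩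
        · simp at hq
      · simp at hq
  | .funcBody x ps R q, Γ, ρ, s, c, ⟨hx, t, hs, h⟩, q', hq => by
    subst hs
    simp only [StmtState.step, List.mem_append, List.mem_map] at hq
    rcases hq with ⟨p, hp, rfl⟩ | hq
    · exact ⟨hx, t ++ [c], by simp, h.step p hp⟩
    · split at hq
      · rename_i o ho
        split_ifs at hq with hc
        · obtain rfl := List.mem_singleton.1 hq
          obtain ⟨ss, hss, hr, rfl⟩ := h.exists_stmts H ho
          -- The flag demanded for the closing brace yields the return judgement demanded by the
          -- typing rule.
          obtain ⟨R', hR', hr⟩ := hr hc.2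
          cases hR'
          exact ⟨ss, .func _ _ _ _ _ _ _ hx hss hr, by simp [Stmt.text, hc.1]⟩
        · simp at hq
      · simp at hq
  | .iteThen q, Γ, ρ, s, c, ⟨e, t, he, hs, h⟩, q', hq => by
    subst hs
    simp only [StmtState.step, List.mem_append, List.mem_map] at hq
    rcases hq with ⟨p, hp, rfl⟩ | hq
    · exact ⟨e, t ++ [c], he, by simp, h.step p hp⟩
    · split at hq
      · rename_i o ho
        split_ifs at hq with hc
        · obtain rfl := List.mem_singleton.1 hq
          obtain ⟨s₁, h₁, hr, rfl⟩ := h.exists_stmt H ho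
          exact ⟨by simp [tElse, chars], e, s₁, o.1, [], he, h₁, hr, rfl, by simp [hc]⟩
        · simp at hq
      · simp at hq
  | .iteElse r q, Γ, ρ, s, c, ⟨e, s₁, Γ₁, t, he, h₁, hr, hs, h⟩, q', hq => by
    subst hs
    simp only [StmtState.step, List.mem_map] at hq
    obtain ⟨p, hp, rfl⟩ := hq
    exact ⟨e, s₁, Γ₁, t ++ [c], he, h₁, hr, by simp, h.step p hp⟩
  | .declKw _, _, _, _, _, h, _, hq => h.leafStep (by simpa only [StmtState.step] using hq)
  | .declName _, _, _, _, _, h, _, hq => h.leafStep (by simpa only [StmtState.step] using hq)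
  | .declType _ _, _, _, _, _, h, _, hq => h.leafStep (by simpa only [StmtState.step] using hq)
  | .declDone _ _, _, _, _, _, h, _, hq => h.leafStep (by simpa only [StmtState.step] using hq)
  | .exprIn _, _, _, _, _, h, _, hq => h.leafStep (by simpa only [StmtState.step] using hq)
  | .exprDone, _, _, _, _, h, _, hq => h.leafStep (by simpa only [StmtState.step] using hq)
  | .retKw _, _, _, _, _, h, _, hq => h.leafStep (by simpa only [StmtState.step] using hq)
  | .retIn _ _, _, _, _, _, h, _, hq => h.leafStep (by simpa only [StmtState.step] using hq)
  | .retDone, _, _, _, _, h, _, hq => h.leafStep (by simpa only [StmtState.step] using hq)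
  | .blockOpen, _, _, _, _, h, _, hq => h.leafStep (by simpa only [StmtState.step] using hq)
  | .blockDone _, _, _, _, _, h, _, hq => h.leafStep (by simpa only [StmtState.step] using hq)
  | .funcKw _, _, _, _, _, h, _, hq => h.leafStep (by simpa only [StmtState.step] using hq)
  | .funcName _, _, _, _, _, h, _, hq => h.leafStep (by simpa only [StmtState.step] using hq)
  | .funcParams _ _, _, _, _, _, h, _, hq => h.leafStep (by simpa only [StmtState.step] using hq)
  | .funcColon _ _, _, _, _, _, h, _, hq => h.leafStep (by simpa only [StmtState.step] using hq)
  | .funcType _ _ _, _, _, _, _, h, _, hq => h.leafStep (by simpa only [StmtState.step] using hq)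
  | .funcDone _ _ _, _, _, _, _, h, _, hq => h.leafStep (by simpa only [StmtState.step] using hq)
  | .iteKw _, _, _, _, _, h, _, hq => h.leafStep (by simpa only [StmtState.step] using hq)
  | .iteCond _, _, _, _, _, h, _, hq => h.leafStep (by simpa only [StmtState.step] using hq)
  | .iteBlank, _, _, _, _, h, _, hq => h.leafStep (by simpa only [StmtState.step] using hq)
  | .iteElseKw _ _, _, _, _, _, h, _, hq => h.leafStep (by simpa only [StmtState.step] using hq)

theorem SeqState.Reads.step : ∀ {q : SeqState} {Γ : Env} {ρ : Option Ty} {s : List Char}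
    {c : Char}, q.Reads H ρ Γ s → ∀ q' ∈ SeqState.step H ρ q c, q'.Reads H ρ Γ (s ++ [c])
  | .init Γ' r, Γ, ρ, s, c, ⟨hs, hΓ, hr⟩, q', hq => by
    subst hs hΓ hr
    simp only [SeqState.step, List.mem_map] at hq
    obtain ⟨p, hp, rfl⟩ := hq
    exact ⟨[], [c], .nop _ _, by simp [Lang.ReturnsIf], rfl, StmtState.reads_startStep H hp⟩
  | .inside Γ' r q, Γ, ρ, s, c, ⟨ss, t, hss, hr, hs, h⟩, q', hq => by
    subst hs
    simp only [SeqState.step, List.mem_append, List.mem_map] at hq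
    rcases hq with ⟨p, hp, rfl⟩ | hq
    · exact ⟨ss, t ++ [c], hss, hr, by simp, h.step p hp⟩
    · split at hq
      · rename_i o ho
        obtain ⟨p, hp, rfl⟩ := List.mem_map.1 hq
        obtain ⟨st, hst, hr', rfl⟩ := h.exists_stmt H ho
        exact ⟨ss ++ [st], [c], hss.append_singleton hst, hr.append_singleton hss hr',
          by rw [Stmt.seqText_append_singleton], StmtState.reads_startStep H hp⟩
      · simp at hq
end

end

/-! ## Completions in the automata for statements and programs -/

section
variable {L : Lang} (H : Heuristic L) [∀ G : Ty, DecidablePred (H.CanReach G)]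

/-- Some character leads from one state of the statement automaton to another. -/
def StmtState.Next (Γ : Env) (ρ : Option Ty) (q q' : StmtState) : Prop :=
  ∃ c, q' ∈ StmtState.step H Γ ρ q c

/-- Some character leads from one state of the automaton for sequences to another. -/
def SeqState.Next (ρ : Option Ty) (q q' : SeqState) : Prop := ∃ c, q' ∈ SeqState.step H ρ q c

/-- The statement automaton leads from `q` to acceptance. -/
def StmtState.Completes (Γ : Env) (ρ : Option Ty) (q : StmtState) : Prop :=
  ∃ q' o, ReflTransGen (StmtState.Next H Γ ρ) q q' ∧ StmtState.out Γ q' = some o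

variable {H}

namespace StmtState
variable {Γ : Env} {ρ : Option Ty}

theorem Completes.trans {q q' : StmtState} (h : ReflTransGen (Next H Γ ρ) q q')
    (h' : Completes H Γ ρ q') : Completes H Γ ρ q := by
  obtain ⟨p, o, hp, ho⟩ := h'
  exact ⟨p, o, h.trans hp, ho⟩

theorem Completes.head {q q' : StmtState} (h : Next H Γ ρ q q')
    (h' : Completes H Γ ρ q') : Completes H Γ ρ q := .trans (.single h) h'

theorem Completes.of_out {q : StmtState} {o : Env × Bool} (h : StmtState.out Γ q = some o) :
    Completes H Γ ρ q := ⟨q, o, .refl, h⟩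

theorem Next.of_leafStep {q q' : StmtState} (c : Char) (h : q' ∈ leafStep H Γ ρ q c) :
    Next H Γ ρ q q' := by
  refine ⟨c, ?_⟩
  cases q <;> first
    | simpa only [step] using h
    | simp [leafStep] at h

/-- A terminal in a statement can be read to its end. -/
theorem Completes.eat {more : List Char → StmtState} {next : List StmtState}
    (hstep : ∀ r c, leafStep H Γ ρ (more r) c = _root_.eat r c more next) {q : StmtState}
    (hq : q ∈ next) (h : Completes H Γ ρ q) {r : List Char} (hr : r ≠ []) :
    Completes H Γ ρ (more r) := by
  refine .trans (reflTransGen_of_eat (more := more) (fun a r hr => ?_) (fun a => ?_) hr) h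
  · exact .of_leafStep a (by simp [hstep, mem_eat, hr])
  · exact .of_leafStep a (by simp [hstep, mem_eat, hq])

theorem Completes.declType (x : Ident) {q q' : TyState} {T : Ty}
    (h : ReflTransGen TyState.Next q q') (hT : q'.out = some T) :
    Completes H Γ ρ (.declType x q) := by
  refine .trans (q' := .declType x q')
    (h.lift _ fun a b ⟨c, hc⟩ => .of_leafStep c (by simp [leafStep, hc])) ?_
  exact .head (q' := .declDone x T) (.of_leafStep cSemi (by simp [leafStep, hT])) (.of_out rfl)

/-- A name that is already taken is no dead end: it is lengthened to a word outside `Γ`. -/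
theorem Completes.declName {x : List Char} (hx : IsWord x) : Completes H Γ ρ (.declName x) := by
  obtain ⟨z, y, hz, hy, hyΓ⟩ := exists_fresh_ident hx (Γ.map Prod.fst)
  obtain ⟨q, hq, q', hqq', hT⟩ := TyState.exists_reflTransGen_start_out .number
  refine .trans (reflTransGen_of_isWord (f := StmtState.declName)
    (fun x c hc => .of_leafStep c (by simp [leafStep, hc])) x z hz) ?_
  rw [← hy]
  refine .head (q' := .declType y q) (.of_leafStep cColon ?_) (.declType y hqq' hT)
  simp [leafStep, toIdent_val, hq, Env.Fresh, hyΓ]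

/-- The statement automaton uses the unrestricted expression automaton, whose transitions include
those of the restriction to any `G`; so every goal serves. -/
theorem Completes.exprIn {q q' : ExprState} {G T : Ty}
    (h : ReflTransGen (ExprState.Next H Γ G) q q') (hT : q'.typ = some T) :
    Completes H Γ ρ (.exprIn q) := by
  refine .trans (q' := .exprIn q') (h.lift _ fun a b ⟨c, hc⟩ => .of_leafStep c
    (by simp [leafStep, ((ExprState.mem_stepAt H).1 hc).1])) ?_
  exact .head (q' := .exprDone) (.of_leafStep cSemi (by simp [leafStep, hT])) (.of_out rfl)

/-- The final state is named, unlike in `Completes`, because closing a function body depends on the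
flag that `retDone` yields. -/
theorem reflTransGen_retIn {q : ExprState} {R : Ty} (h : ExprState.Completes H Γ R q R) :
    ReflTransGen (Next H Γ ρ) (.retIn R q) .retDone := by
  obtain ⟨q', hq', hR⟩ := h
  refine .tail (b := .retIn R q')
    (hq'.lift _ fun a b ⟨c, hc⟩ => .of_leafStep c (by simp [leafStep, hc])) ?_
  exact .of_leafStep cSemi (by simp [leafStep, hR])

theorem reflTransGen_retKw {R : Ty} {r : List Char} (hr : r ≠ []) :
    ReflTransGen (Next H Γ (some R)) (.retKw r) .retDone := by
  obtain ⟨q, hq, hc⟩ := ExprState.inhabited H R Γ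
  refine .trans (b := .retIn R q) (reflTransGen_of_eat (more := StmtState.retKw)
    (fun a r hr => ?_) (fun a => ?_) hr) (reflTransGen_retIn hc)
  · exact .of_leafStep a (by simp [leafStep, mem_eat, hr])
  · exact .of_leafStep a (by simp [leafStep, mem_eat, hq])

theorem Completes.blockIn {q q' : SeqState} {o : Env × Bool}
    (h : ReflTransGen (SeqState.Next H ρ) q q') (ho : q'.out = some o) :
    Completes H Γ ρ (.blockIn q) := by
  refine .trans (q' := .blockIn q')
    (h.lift _ fun a b ⟨c, hc⟩ => ⟨c, by simp [step, hc]⟩) ?_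
  exact .head (q' := .blockDone o.2) ⟨cRBrace, by simp [step, ho]⟩ (.of_out rfl)

/-- The empty block is valid in every environment, inside and outside functions; it serves as the
filler for missing branches. -/
theorem Completes.blockOpen : Completes H Γ ρ .blockOpen :=
  .head (q' := .blockIn (.init Γ false)) (.of_leafStep cLBrace (by simp [leafStep]))
    (.blockIn .refl rfl)

theorem blockOpen_mem_start : StmtState.blockOpen ∈ start Γ ρ := by simp [start]

theorem Completes.funcBody {x : Ident} {ps : List Param} {R : Ty} {q q' : SeqState} {Γ' : Env}
    (h : ReflTransGen (SeqState.Next H (some R)) q q') (ho : q'.out = some (Γ', true)) :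
    Completes H Γ ρ (.funcBody x ps R q) := by
  refine .trans (q' := .funcBody x ps R q')
    (h.lift _ fun a b ⟨c, hc⟩ => ⟨c, by simp [step, hc]⟩) ?_
  exact .head (q' := .funcDone x ps R) ⟨cRBrace, by simp [step, ho]⟩ (.of_out rfl)

theorem Completes.iteElse (r : Bool) {q : StmtState} (h : Completes H Γ ρ q) :
    Completes H Γ ρ (.iteElse r q) := by
  obtain ⟨q', o, hq', ho⟩ := h
  exact .trans (q' := .iteElse r q') (hq'.lift _ fun a b ⟨c, hc⟩ => ⟨c, by simp [step, hc]⟩)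
    (.of_out (o := (Γ, r && o.2)) (by simp [StmtState.out, ho]))

theorem Completes.iteElseKw (r : Bool) {l : List Char} (hl : l ≠ []) :
    Completes H Γ ρ (.iteElseKw r l) :=
  .eat (more := .iteElseKw r) (fun _ _ => rfl) (List.mem_map_of_mem blockOpen_mem_start)
    (.iteElse r .blockOpen) hl

theorem Completes.iteThen {q : StmtState} (h : Completes H Γ ρ q) :
    Completes H Γ ρ (.iteThen q) := by
  obtain ⟨q', o, hq', ho⟩ := h
  refine .trans (q' := .iteThen q')
    (hq'.lift _ fun a b ⟨c, hc⟩ => ⟨c, by simp [step, hc]⟩) ?_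
  exact .head (q' := .iteElseKw o.2 tElse) ⟨cBlank, by simp [step, ho]⟩
    (.iteElseKw _ (by simp [tElse, chars]))

theorem Completes.iteBlank : Completes H Γ ρ .iteBlank :=
  .head (q' := .iteThen .blockOpen)
    (.of_leafStep cBlank (by simp [leafStep, blockOpen_mem_start])) (.iteThen .blockOpen)

theorem Completes.iteCond {q : ExprState} (h : ExprState.Completes H Γ .boolean q .boolean) :
    Completes H Γ ρ (.iteCond q) := by
  obtain ⟨q', hq', hR⟩ := h
  refine .trans (q' := .iteCond q')
    (hq'.lift _ fun a b ⟨c, hc⟩ => .of_leafStep c (by simp [leafStep, hc])) ?_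
  exact .head (q' := .iteBlank) (.of_leafStep cRParen (by simp [leafStep, hR])) .iteBlank

theorem Completes.iteKw {r : List Char} (hr : r ≠ []) : Completes H Γ ρ (.iteKw r) := by
  obtain ⟨q, hq, hc⟩ := ExprState.inhabited H .boolean Γ
  exact .eat (more := .iteKw) (fun _ _ => rfl) (List.mem_map_of_mem hq) (.iteCond hc) hr

end StmtState

/-- Treats both kinds of accepting states alike: the next statement begins with the environment and
flag that the state yields. -/
theorem SeqState.mem_step_of_out {ρ : Option Ty} {q : SeqState} {o : Env × Bool} {c : Char}
    (ho : q.out = some o) {p : StmtState} (hp : p ∈ StmtState.startStep H o.1 ρ c) :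
    SeqState.inside o.1 o.2 p ∈ SeqState.step H ρ q c := by
  cases q with
  | init Γ r =>
    cases ho
    simp [SeqState.step, hp]
  | inside Γ r q =>
    simp only [SeqState.out, Option.map_eq_some_iff] at ho
    obtain ⟨o', ho', rfl⟩ := ho
    simp [SeqState.step, ho', hp]

theorem SeqState.reflTransGen_inside {ρ : Option Ty} (Γ : Env) (r : Bool) {q q' : StmtState}
    (h : ReflTransGen (StmtState.Next H Γ ρ) q q') :
    ReflTransGen (SeqState.Next H ρ) (.inside Γ r q) (.inside Γ r q') :=
  h.lift _ fun a b ⟨c, hc⟩ => ⟨c, by simp [SeqState.step, hc]⟩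

/-- Within a function, a return statement can be appended. -/
theorem SeqState.exists_reflTransGen_out_true {R : Ty} {q : SeqState} {o : Env × Bool}
    (ho : q.out = some o) :
    ∃ q' Γ', ReflTransGen (SeqState.Next H (some R)) q q' ∧ q'.out = some (Γ', true) := by
  -- The initial state of the return statement is not itself entered, so the first character of its
  -- keyword is read in the transition from `q`.
  obtain ⟨a, r, hr, hr'⟩ : ∃ a r, tReturn = a :: r ∧ r ≠ [] := ⟨_, _, rfl, by simp⟩
  refine ⟨.inside o.1 o.2 .retDone, o.1, .head (b := .inside o.1 o.2 (.retKw r)) ⟨a, ?_⟩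
    (SeqState.reflTransGen_inside _ _ (StmtState.reflTransGen_retKw hr')),
    by simp [SeqState.out, StmtState.out]⟩
  refine SeqState.mem_step_of_out ho (List.mem_flatMap.2 ⟨.retKw tReturn, by simp [StmtState.start], ?_⟩)
  simp [StmtState.leafStep, hr, mem_eat, hr']

theorem StmtState.Completes.funcBody_init {Γ : Env} {ρ : Option Ty} (x : Ident) (ps : List Param)
    (R : Ty) (Γ' : Env) : Completes H Γ ρ (.funcBody x ps R (.init Γ' false)) := by
  obtain ⟨q', Γ₁, hq', ho⟩ := SeqState.exists_reflTransGen_out_true (H := H) (R := R)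
    (q := .init Γ' false) rfl
  exact .funcBody hq' ho

theorem StmtState.Completes.funcType {Γ : Env} {ρ : Option Ty} (x : Ident) (ps : List Param)
    {q q' : TyState} {R : Ty} (h : ReflTransGen TyState.Next q q') (hR : q'.out = some R) :
    Completes H Γ ρ (.funcType x ps q) := by
  refine .trans (q' := .funcType x ps q')
    (h.lift _ fun a b ⟨c, hc⟩ => .of_leafStep c (by simp [leafStep, hc])) ?_
  exact .head (.of_leafStep cLBrace (by simp [leafStep, hR]; rfl)) (.funcBody_init x ps R _)

theorem StmtState.Completes.funcColon {Γ : Env} {ρ : Option Ty} (x : Ident) (ps : List Param) :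
    Completes H Γ ρ (.funcColon x ps) := by
  obtain ⟨q, hq, q', hqq', hT⟩ := TyState.exists_reflTransGen_start_out .number
  exact .head (q' := .funcType x ps q) (.of_leafStep cColon (by simp [leafStep, hq]))
    (.funcType x ps hqq' hT)

theorem StmtState.Completes.funcParams {Γ : Env} {ρ : Option Ty} (x : Ident) {p p' : ParamState}
    {ps : List Param} (h : ReflTransGen ParamState.Next p p') (ho : p'.out = some ps) :
    Completes H Γ ρ (.funcParams x p) := by
  refine .trans (q' := .funcParams x p')
    (h.lift _ fun a b ⟨c, hc⟩ => .of_leafStep c (by simp [leafStep, hc])) ?_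
  exact .head (q' := .funcColon x ps) (.of_leafStep cRParen (by simp [leafStep, ho]))
    (.funcColon x ps)

theorem StmtState.Completes.funcName {Γ : Env} {ρ : Option Ty} {x : List Char} (hx : IsWord x) :
    Completes H Γ ρ (.funcName x) := by
  obtain ⟨z, y, hz, hy, hyΓ⟩ := exists_fresh_ident hx (Γ.map Prod.fst)
  refine .trans (reflTransGen_of_isWord (f := StmtState.funcName)
    (fun x c hc => .of_leafStep c (by simp [leafStep, hc])) x z hz) ?_
  rw [← hy]
  refine .head (q' := .funcParams y .empty) (.of_leafStep cLParen ?_) (.funcParams y .refl rfl)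
  simp [leafStep, toIdent_val, Env.Fresh, hyΓ]

mutual
/-- Every state of the statement automaton that occurs in a run leads to acceptance. -/
theorem StmtState.Reads.completes : ∀ {q : StmtState} {Γ : Env} {ρ : Option Ty} {s : List Char},
    q.Reads H Γ ρ s → StmtState.Completes H Γ ρ q
  | .declKw r, _, _, _, h => .eat (more := .declKw) (fun _ _ => rfl) (List.mem_singleton_self _)
      (.declName (by simp [IsWord])) h.1
  | .declName _, _, _, _, h => .declName h.1
  | .declType x _, _, _, _, ⟨_, _, _, h⟩ => by
    obtain ⟨q', T, hq', hT⟩ := h.exists_out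
    exact .declType x hq' hT
  | .declDone _ _, _, _, _, _ => .of_out rfl
  | .exprIn q, _, _, _, h => by
    obtain ⟨D, hD⟩ := ExprState.Reads.exists_canReach H h
    obtain ⟨q', hq', hT⟩ := ExprState.Reads.completes h hD
    exact .exprIn hq' hT
  | .exprDone, _, _, _, _ => .of_out rfl
  | .retKw _, _, some _, _, h => ⟨_, _, StmtState.reflTransGen_retKw h.2.1, rfl⟩
  | .retKw _, _, none, _, h => by simp [StmtState.Reads] at h
  | .retIn _ _, _, _, _, ⟨_, hR, _, _, h⟩ =>
    ⟨_, _, StmtState.reflTransGen_retIn (h.completes hR), rfl⟩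
  | .retDone, _, _, _, _ => .of_out rfl
  | .blockOpen, _, _, _, _ => .blockOpen
  | .blockIn _, _, _, _, ⟨_, _, h⟩ => by
    obtain ⟨q', o, hq', ho⟩ := h.exists_out
    exact .blockIn hq' ho
  | .blockDone _, _, _, _, _ => .of_out rfl
  | .funcKw _, _, _, _, h => .eat (more := .funcKw) (fun _ _ => rfl) (List.mem_singleton_self _)
      (.funcName (by simp [IsWord])) h.1
  | .funcName _, _, _, _, h => .funcName h.1
  | .funcParams x _, _, _, _, ⟨_, _, _, h⟩ => by
    obtain ⟨p', ps, hp', ho⟩ := h.exists_out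
    exact .funcParams x hp' ho
  | .funcColon x ps, _, _, _, _ => .funcColon x ps
  | .funcType x ps _, _, _, _, ⟨_, _, _, h⟩ => by
    obtain ⟨q', T, hq', hT⟩ := h.exists_out
    exact .funcType x ps hq' hT
  | .funcBody x ps R _, _, _, _, ⟨_, _, _, h⟩ => by
    obtain ⟨q', o, hq', ho⟩ := h.exists_out
    -- A return statement is appended even if the body returns already, which is harmless and avoids
    -- a case distinction.
    obtain ⟨q'', Γ', hq'', ho'⟩ := SeqState.exists_reflTransGen_out_true (H := H) (R := R) ho
    exact .funcBody (hq'.trans hq'') ho'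
  | .funcDone _ _ _, _, _, _, _ => .of_out rfl
  | .iteKw _, _, _, _, h => .iteKw h.1
  | .iteCond _, _, _, _, ⟨hb, _, _, h⟩ => .iteCond (h.completes hb)
  | .iteBlank, _, _, _, _ => .iteBlank
  | .iteThen _, _, _, _, ⟨_, _, _, _, h⟩ => .iteThen h.completes
  | .iteElseKw r _, _, _, _, h => .iteElseKw r h.1
  | .iteElse r _, _, _, _, ⟨_, _, _, _, _, _, _, _, h⟩ => .iteElse r h.completes

/-- Every state of the automaton for sequences that occurs in a run leads to acceptance. -/
theorem SeqState.Reads.exists_out : ∀ {q : SeqState} {Γ : Env} {ρ : Option Ty} {s : List Char},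
    q.Reads H ρ Γ s → ∃ q' o, ReflTransGen (SeqState.Next H ρ) q q' ∧ q'.out = some o
  | .init Γ' r, _, _, _, _ => ⟨_, _, .refl, rfl⟩
  | .inside Γ' r q, _, _, _, ⟨_, _, _, _, _, h⟩ => by
    obtain ⟨q', o, hq', ho⟩ := h.completes
    exact ⟨.inside Γ' r q', _, SeqState.reflTransGen_inside Γ' r hq', by
      simp [SeqState.out, ho]; rfl⟩
end

-- The program automaton

/-- The state and the text after a run of the program automaton match. -/
theorem programAutomaton_reads {s : List Char} {q : (programAutomaton H).State}
    (h : q ∈ (programAutomaton H).γ (programAutomaton H).I s) :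
    SeqState.Reads H none [] q s := by
  refine (programAutomaton H).invariant_of_mem_γ (P := SeqState.Reads H none []) ?_ ?_ h
  · intro q hq
    obtain rfl := List.mem_singleton.1 hq
    exact ⟨rfl, rfl, rfl⟩
  · exact fun q s c h q' hq => SeqState.Reads.step h q' hq

end

theorem mainTheorem1 (L : Lang) (H : Heuristic L) [∀ G : Ty, DecidablePred (H.CanReach G)] :
    (programAutomaton H).IsPrefixAutomaton ∧ (programAutomaton H).language ⊆ L.programs := by
  constructor
  · intro s q hq
    obtain ⟨q', o, hq', ho⟩ := (programAutomaton_reads hq).exists_out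
    -- `SeqState.Next` outside functions unfolds to the step relation of the program automaton.
    obtain ⟨w, hw⟩ := (programAutomaton H).exists_mem_γ_iff.2 hq'
    exact ⟨w, q', hw, by simp [programAutomaton, ho]⟩
  · rintro s ⟨q, hq, hF⟩
    obtain ⟨o, ho⟩ := Option.isSome_iff_exists.1 hF
    obtain ⟨M, hM, -, hs⟩ := (programAutomaton_reads hq).exists_stmts H ho
    exact ⟨M, o.1, hM, hs⟩
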